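/- Write $\mathbb R_+=[0,\infty)$, let $\lambda$ be Lebesgue measure on $\mathbb R_+$, and for a measurable $\phi$ on $\mathbb R_+$ put $\lambda\phi=\int_0^\infty\phi(y)\,dy$. Let $f\ge 0$ on $\mathbb R_+^4$, $g,g'\ge 0$ on $\mathbb R_+^3$ and $h,h',l,l'\ge 0$ on $\mathbb R_+^2$ be measurable and finite-valued. Let $\{(\tau_j,\vartheta_j)\}_{j\ge1}$ and, for each $j\ge1$, $\{(\sigma_{jk},\chi_{jk})\}_{k\ge1}$ be unit rate Poisson processes on $\mathbb R_+^2$, let $\{(\rho_k,\rho_k',\eta_k)\}_{k\ge1}$ be a unit rate Poisson process on $\mathbb R_+^3$, let $\zeta_{\{i,j\}}$ ($1\le i\le j$) be i.i.d. uniform on $[0,1]$, and let $\beta,\gamma\ge0$ be (finite) random variables, where all the (enumerated) Poisson processes, the family $(\zeta_{\{i,j\}})$ and the pair $(\beta,\gamma)$ are mutually independent. Let $\lambda_{\mathrm D}$ be Lebesgue measure (arc length) on the diagonal of $\mathbb R_+^2$. For a fixed (non-random) $\alpha\in\mathbb R_+$ consider the random measure on $\mathbb R_+^2$ \begin{align*}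 \xi={}&\sum_{i,j} f(\alpha,\vartheta_i,\vartheta_j,\zeta_{\{i,j\}})\,\delta_{(\tau_i,\tau_j)}+\beta\lambda_{\mathrm D}+\gamma\lambda^2\\ &+\sum_{j,k}\Big(g(\alpha,\vartheta_j,\chi_{jk})\,\delta_{(\tau_j,\sigma_{jk})}+g'(\alpha,\vartheta_j,\chi_{jk})\,\delta_{(\sigma_{jk},\tau_j)}\Big)\\ &+\sum_j\Big(h(\alpha,\vartheta_j)\,(\delta_{\tau_j}\otimes\lambda)+h'(\alpha,\vartheta_j)\,(\lambda\otimes\delta_{\tau_j})\Big)\\ &+\sum_k\Big(l(\alpha,\eta_k)\,\delta_{(\rho_k,\rho_k')}+l'(\alpha,\eta_k)\,\delta_{(\rho_k',\rho_k)}\Big). \end{align*} Suppress $\alpha$ from the notation, write $\hat\phi=\phi\wedge1$ for any function $\phi$, and set $$f_1(x)=\int_0^\infty\!\int_0^1\hat f(x,y,z)\,dz\,dy,\qquad f_2(y)=\int_0^\infty\!\int_0^1\hat f(x,y,z)\,dz\,dx,$$ $$g_1(x)=\int_0^\infty\hat g(x,y)\,dy,\qquad g'_1(x)=\int_0^\infty\hat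 g'(x,y)\,dy .$$ Then $\xi$ is a.s. locally finite (that is, with probability one $\xi(B)<\infty$ for all bounded measurable $B\subset\mathbb R_+^2$) if and only if all of the following conditions hold: (i) $\lambda(\hat l+\hat l'+\hat h+\hat h')<\infty$; (ii) $\lambda\{g_1=\infty\}=\lambda\{g'_1=\infty\}=0$; (iii) $\lambda(\hat g_1+\hat g'_1)<\infty$, where $\hat g_1=g_1\wedge1$ and $\hat g'_1=g'_1\wedge1$; (iv) $\lambda\{f_i=\infty\}=0$ and $\lambda\{f_i>1\}<\infty$ for $i=1,2$; (v) $\int_0^\infty\!\int_0^\infty\!\int_0^1\hat f(x,y,z)\,\mathbf 1\{f_1(x)\vee f_2(y)\le1\}\,dz\,dy\,dx<\infty$; (vi) $\int_0^\infty\!\int_0^1\hat f(x,x,z)\,dz\,dx<\infty$. -/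

import Mathlib

open MeasureTheory ProbabilityTheory
open scoped NNReal ENNReal

noncomputable section

namespace Kallenberg

/-! ### Lebesgue measure on the half line, Poisson processes -/

/-- Lebesgue measure `λ` on `ℝ₊ = [0, ∞)`. -/
def leb : Measure ℝ≥0 := (volume.restrict (Set.Ici (0 : ℝ))).map Real.toNNReal

instance : SFinite leb := by unfold leb; infer_instance

/-- Lebesgue measure (arc length) on the diagonal of `ℝ₊²`: the curve `x ↦ (x, x)` has speed `√2`,
so that `[0, 1]²` gets mass `√2`. -/
def lebDiag : Measure (ℝ≥0 × ℝ≥0) :=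
  ENNReal.ofReal (Real.sqrt 2) • leb.map (fun x => (x, x))

/-- The random counting measure `∑ⱼ δ_{Xⱼ}` of a sequence of random points. -/
def pointMeasure {Ω E : Type*} [MeasurableSpace E] (X : ℕ → Ω → E) (ω : Ω) : Measure E :=
  Measure.sum fun j => Measure.dirac (X j ω)

/-- The random points `X₀, X₁, …` enumerate a Poisson process with intensity measure `μ`: the number
of points in a set `B` of finite measure is Poisson distributed with mean `μ B`, and the numbers of
points in disjoint sets are independent. -/
structure IsPoissonProcess {Ω E : Type*} [MeasurableSpace Ω] [MeasurableSpace E]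
    (P : Measure Ω) (μ : Measure E) (X : ℕ → Ω → E) : Prop where
  measurable : ∀ j, Measurable (X j)
  hasLaw_count : ∀ B : Set E, MeasurableSet B → ∀ r : ℝ≥0, μ B = r →
    HasLaw (fun ω => pointMeasure X ω B)
      ((poissonMeasure r).map (fun n : ℕ => (n : ℝ≥0∞))) P
  indep_count : ∀ (n : ℕ) (B : Fin n → Set E), (∀ i, MeasurableSet (B i)) →
    Pairwise (fun i j => Disjoint (B i) (B j)) →
    iIndepFun (fun i ω => pointMeasure X ω (B i)) P

/-! ### The ingredients of the representation -/

/-- The deterministic functions in the representation (the first argument is `α`);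
`g'`, `h'`, `l'` are the second functions of the respective pairs. -/
structure Coeffs where
  f : ℝ≥0 × ℝ≥0 × ℝ≥0 × ℝ≥0 → ℝ≥0
  g : ℝ≥0 × ℝ≥0 × ℝ≥0 → ℝ≥0
  g' : ℝ≥0 × ℝ≥0 × ℝ≥0 → ℝ≥0
  h : ℝ≥0 × ℝ≥0 → ℝ≥0
  h' : ℝ≥0 × ℝ≥0 → ℝ≥0
  l : ℝ≥0 × ℝ≥0 → ℝ≥0
  l' : ℝ≥0 × ℝ≥0 → ℝ≥0
  measurable_f : Measurable f
  measurable_g : Measurable g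
  measurable_g' : Measurable g'
  measurable_h : Measurable h
  measurable_h' : Measurable h'
  measurable_l : Measurable l
  measurable_l' : Measurable l'

/-- The random objects in the representation, on a sample space `Ω`. Indices run over
`ℕ = {0, 1, …}`. -/
structure Noise (Ω : Type*) where
  /-- the points `(τⱼ, ϑⱼ)` -/
  vertex : ℕ → Ω → ℝ≥0 × ℝ≥0
  /-- the points `(σⱼₖ, χⱼₖ)`, as a function of `j` and then `k` -/
  star : ℕ → ℕ → Ω → ℝ≥0 × ℝ≥0
  /-- the points `(ρₖ, ρ'ₖ, ηₖ)` -/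
  edge : ℕ → Ω → ℝ≥0 × ℝ≥0 × ℝ≥0
  /-- the variables `ζ_{i, j}`, indexed by unordered pairs with `i = j` allowed -/
  label : Sym2 ℕ → Ω → ℝ≥0
  /-- the coefficient `β` of the Lebesgue measure on the diagonal -/
  β : Ω → ℝ≥0
  /-- the coefficient `γ` of the Lebesgue measure on the quadrant -/
  γ : Ω → ℝ≥0

/-- The independent sources of randomness. -/
inductive Source where
  | vertex
  | star (j : ℕ)
  | edge
  | label (e : Sym2 ℕ)
  | drift

/-- The σ-algebra on `Ω` generated by each of the sources. -/
def Noise.sigma {Ω : Type*} (N : Noise Ω) : Source → MeasurableSpace Ω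
  | .vertex => MeasurableSpace.comap (fun ω j => N.vertex j ω) inferInstance
  | .star j => MeasurableSpace.comap (fun ω k => N.star j k ω) inferInstance
  | .edge => MeasurableSpace.comap (fun ω k => N.edge k ω) inferInstance
  | .label e => MeasurableSpace.comap (N.label e) inferInstance
  | .drift => MeasurableSpace.comap (fun ω => (N.β ω, N.γ ω)) inferInstance

/-- The joint law of the random objects: unit rate Poisson processes on `ℝ₊²`, `ℝ₊²` (one for each
`j`) and `ℝ₊³`, variables `ζ` that are uniform on `[0, 1]`, and random variables `β, γ ≥ 0`, where
the Poisson processes, the variables `ζ` and the pair `(β, γ)` are mutually independent. -/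
structure Noise.IsAdmissible {Ω : Type*} [MeasurableSpace Ω] (N : Noise Ω) (P : Measure Ω) :
    Prop where
  vertex : IsPoissonProcess P (leb.prod leb) N.vertex
  star : ∀ j, IsPoissonProcess P (leb.prod leb) (N.star j)
  edge : IsPoissonProcess P (leb.prod (leb.prod leb)) N.edge
  measurable_label : ∀ e, Measurable (N.label e)
  label : ∀ e, HasLaw (N.label e) (leb.restrict (Set.Icc 0 1)) P
  measurable_β : Measurable N.β
  measurable_γ : Measurable N.γ
  indep : iIndep N.sigma P

section Names

variable {Ω : Type*} (N : Noise Ω)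

def Noise.τ (j : ℕ) (ω : Ω) : ℝ≥0 := (N.vertex j ω).1
def Noise.ϑ (j : ℕ) (ω : Ω) : ℝ≥0 := (N.vertex j ω).2
def Noise.σ (j k : ℕ) (ω : Ω) : ℝ≥0 := (N.star j k ω).1
def Noise.χ (j k : ℕ) (ω : Ω) : ℝ≥0 := (N.star j k ω).2
def Noise.ρ (k : ℕ) (ω : Ω) : ℝ≥0 := (N.edge k ω).1
def Noise.ρ' (k : ℕ) (ω : Ω) : ℝ≥0 := (N.edge k ω).2.1
def Noise.η (k : ℕ) (ω : Ω) : ℝ≥0 := (N.edge k ω).2.2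
def Noise.ζ (i j : ℕ) (ω : Ω) : ℝ≥0 := N.label s(i, j) ω

end Names

/-- The random measure `ξ` on `ℝ₊²` given by the representation. -/
def randomMeasure {Ω : Type*} (C : Coeffs) (α : ℝ≥0) (N : Noise Ω) (ω : Ω) :
    Measure (ℝ≥0 × ℝ≥0) :=
  Measure.sum (fun p : ℕ × ℕ =>
      (C.f (α, N.ϑ p.1 ω, N.ϑ p.2 ω, N.ζ p.1 p.2 ω) : ℝ≥0∞) •
        Measure.dirac (N.τ p.1 ω, N.τ p.2 ω))
    + (N.β ω : ℝ≥0∞) • lebDiag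
    + (N.γ ω : ℝ≥0∞) • leb.prod leb
    + Measure.sum (fun p : ℕ × ℕ =>
        (C.g (α, N.ϑ p.1 ω, N.χ p.1 p.2 ω) : ℝ≥0∞) •
            Measure.dirac (N.τ p.1 ω, N.σ p.1 p.2 ω)
          + (C.g' (α, N.ϑ p.1 ω, N.χ p.1 p.2 ω) : ℝ≥0∞) •
            Measure.dirac (N.σ p.1 p.2 ω, N.τ p.1 ω))
    + Measure.sum (fun j : ℕ =>
        (C.h (α, N.ϑ j ω) : ℝ≥0∞) • (Measure.dirac (N.τ j ω)).prod leb
          + (C.h' (α, N.ϑ j ω) : ℝ≥0∞) • leb.prod (Measure.dirac (N.τ j ω)))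
    + Measure.sum (fun k : ℕ =>
        (C.l (α, N.η k ω) : ℝ≥0∞) • Measure.dirac (N.ρ k ω, N.ρ' k ω)
          + (C.l' (α, N.η k ω) : ℝ≥0∞) • Measure.dirac (N.ρ' k ω, N.ρ k ω))

/-- A random measure on `ℝ₊²` is locally finite if, with probability one, it is finite on all
bounded measurable sets. -/
def IsLocallyFinite {Ω : Type*} [MeasurableSpace Ω] (P : Measure Ω)
    (ξ : Ω → Measure (ℝ≥0 × ℝ≥0)) : Prop :=
  ∀ᵐ ω ∂P, ∀ B : Set (ℝ≥0 × ℝ≥0), MeasurableSet B → Bornology.IsBounded B → ξ ω B < ∞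

/-! ### The integrability conditions -/

/-- The truncation `φ̂ = φ ∧ 1`. -/
def trunc (a : ℝ≥0∞) : ℝ≥0∞ := min a 1

namespace Coeffs

variable (C : Coeffs) (α : ℝ≥0)

/-- `f₁(x) = ∫₀^∞ ∫₀¹ f̂(x, y, z) dz dy` -/
def f₁ (x : ℝ≥0) : ℝ≥0∞ := ∫⁻ y, ∫⁻ z in Set.Icc 0 1, trunc (C.f (α, x, y, z)) ∂leb ∂leb

/-- `f₂(y) = ∫₀^∞ ∫₀¹ f̂(x, y, z) dz dx` -/
def f₂ (y : ℝ≥0) : ℝ≥0∞ := ∫⁻ x, ∫⁻ z in Set.Icc 0 1, trunc (C.f (α, x, y, z)) ∂leb ∂leb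

/-- `g₁(x) = ∫₀^∞ ĝ(x, y) dy` -/
def g₁ (x : ℝ≥0) : ℝ≥0∞ := ∫⁻ y, trunc (C.g (α, x, y)) ∂leb

/-- `g'₁(x) = ∫₀^∞ ĝ'(x, y) dy` -/
def g'₁ (x : ℝ≥0) : ℝ≥0∞ := ∫⁻ y, trunc (C.g' (α, x, y)) ∂leb

/-- Conditions (i) to (vi), for a given value of `α`. -/
structure Conditions : Prop where
  i : ∫⁻ x, (trunc (C.l (α, x)) + trunc (C.l' (α, x)) + trunc (C.h (α, x)) + trunc (C.h' (α, x)))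
    ∂leb < ∞
  ii : leb {x | C.g₁ α x = ∞} = 0 ∧ leb {x | C.g'₁ α x = ∞} = 0
  iii : ∫⁻ x, (trunc (C.g₁ α x) + trunc (C.g'₁ α x)) ∂leb < ∞
  iv : (leb {x | C.f₁ α x = ∞} = 0 ∧ leb {x | 1 < C.f₁ α x} < ∞) ∧
    (leb {y | C.f₂ α y = ∞} = 0 ∧ leb {y | 1 < C.f₂ α y} < ∞)
  v : ∫⁻ x, ∫⁻ y, ∫⁻ z in Set.Icc 0 1,
    trunc (C.f (α, x, y, z)) * (if max (C.f₁ α x) (C.f₂ α y) ≤ 1 then 1 else 0)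
      ∂leb ∂leb ∂leb < ∞
  vi : ∫⁻ x, ∫⁻ z in Set.Icc 0 1, trunc (C.f (α, x, x, z)) ∂leb ∂leb < ∞

end Coeffs

end Kallenberg

end

/-! Local finiteness means finiteness on every box $[0,n]^2$, where the nonnegative terms of $\xi$
can be tested one at a time. A series of finite terms converges iff its truncation at 1 does, so
only sums of $[0,1]$-valued functions matter.

Sufficiency rests on first moments, necessity on second moments. If $Y<\infty$ a.s., then every
$0\le Z\le Y$ with $EZ<\infty$ and $EZ^2\le K((EZ)^2+EZ)$ satisfies $EZ\le M$, where $M$ depends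
only on $Y$ and $K$ (`exists_bound_lintegral`). Applied to cut-offs of a Poisson sum, this gives the
one-dimensional criterion `IsPoissonProcess.ae_tsum_lt_top_iff`, which settles $h,h',l,l'$. Freezing
the vertices turns the $g$-term into the Poisson sum of $g_1(\vartheta_j)$, and the $f$-term into
the double sum of $\psi(x,y)=\int_0^1\hat f(x,y,z)\,dz$ over pairs of vertices.

The double sum is the heart of the matter. With the two vertices taken from disjoint strips of
positions of unit width, no pair $i=j$ contributes, and for $\varphi\le\psi$ with mass $m$ and
marginals $\varphi_1,\varphi_2$ the second moment is at most
$m^2+\int\varphi_1^2+\int\varphi_2^2+\int\!\int\varphi^2$. Hence the mass is bounded over all such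
$\varphi$ of bounded support with $\int\varphi_1^2+\int\varphi_2^2\le K(m^2+m)$. Restricting $\psi$
to the points where both marginals are at most 1 gives (v); rescaling $\psi$ over a set $B$ on which
$f_1>c$, so that its marginal there becomes $c$, bounds $c\,\lambda(B)$ and gives (iv). The pairs
$i=j$ alone give (vi).

Conversely, (v) and (vi) make the mean finite where both marginals are at most 1, and by (iv) each
bounded strip contains only finitely many vertices with a marginal above 1, all of these marginals
being finite. -/

namespace Kallenberg

/-! ### The second moment method -/

section SecondMoment

variable {Ω : Type*} [MeasurableSpace Ω] {P : Measure Ω} [IsProbabilityMeasure P]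

theorem exists_measure_lt_le {Y : Ω → ℝ≥0∞} (hYm : Measurable Y) (hY : ∀ᵐ ω ∂P, Y ω < ∞)
    {ε : ℝ≥0∞} (hε : 0 < ε) : ∃ T : ℝ≥0, P {ω | (T : ℝ≥0∞) < Y ω} ≤ ε := by
  have h := tendsto_measure_iInter_atTop (μ := P) (s := fun n : ℕ => {ω | (n : ℝ≥0∞) < Y ω})
    (fun n => (measurableSet_lt measurable_const hYm).nullMeasurableSet)
    (fun m n hmn ω (hω : (n : ℝ≥0∞) < Y ω) =>
      lt_of_le_of_lt (by exact_mod_cast hmn : (m : ℝ≥0∞) ≤ n) hω)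
    ⟨0, measure_ne_top _ _⟩
  have h0 : P (⋂ n : ℕ, {ω | (n : ℝ≥0∞) < Y ω}) = 0 := by
    refine measure_mono_null ?_ (ae_iff.1 hY)
    intro ω hω hlt
    obtain ⟨n, hn⟩ := ENNReal.exists_nat_gt hlt.ne
    exact lt_asymm hn (Set.mem_iInter.1 hω n)
  rw [h0] at h
  obtain ⟨n, hn⟩ := (h.eventually_le_const hε).exists
  exact ⟨n, by simpa using hn⟩

theorem ennreal_two_mul_le_add_sq (a b : ℝ≥0∞) : 2 * a * b ≤ a ^ 2 + b ^ 2 := by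
  rcases eq_or_ne a ∞ with rfl | ha
  · simp
  rcases eq_or_ne b ∞ with rfl | hb
  · simp
  lift a to ℝ≥0 using ha
  lift b to ℝ≥0 using hb
  exact_mod_cast two_mul_le_add_sq a b

/-- A Paley–Zygmund type bound: random variables dominated by an almost surely finite one, with
second moment controlled by the mean, have bounded means. -/
theorem exists_bound_lintegral {Y : Ω → ℝ≥0∞} (hYm : Measurable Y) (hY : ∀ᵐ ω ∂P, Y ω < ∞)
    (K : ℝ≥0) : ∃ M : ℝ≥0, ∀ Z : Ω → ℝ≥0∞, Measurable Z → (∀ ω, Z ω ≤ Y ω) →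
      ∫⁻ ω, Z ω ∂P ≠ ∞ → ∫⁻ ω, Z ω ^ 2 ∂P ≤ K * ((∫⁻ ω, Z ω ∂P) ^ 2 + ∫⁻ ω, Z ω ∂P) →
      ∫⁻ ω, Z ω ∂P ≤ M := by
  set L : ℝ≥0 := K + 1 with hL
  have hL0 : 0 < L := by positivity
  obtain ⟨T, hT⟩ := exists_measure_lt_le hYm hY (ε := ((4 * L)⁻¹ : ℝ≥0)) (by
    exact_mod_cast inv_pos.2 (by positivity))
  refine ⟨2 * T + 1, fun Z hZm hZY hZ h2 => ?_⟩
  set m := ∫⁻ ω, Z ω ∂P with hm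
  set A := {ω | (T : ℝ≥0∞) < Y ω} with hA
  have hAm : MeasurableSet A := measurableSet_lt measurable_const hYm
  -- Off `A` use $Z\le Y\le T$; on `A` use $2ab\le a^2+b^2$ with $b=2Lm$. Since $P(A)\le 1/(4L)$,
  -- the square $b^2$ integrates to at most $Lm^2$, and the second moment adds another $Lm^2$. Half
  -- of the left side $4Lm^2$ survives, which leaves $2m\le 4T+1$.
  have hpt : ∀ ω, 4 * L * m * Z ω ≤
      4 * L * m * T + (Z ω ^ 2 + A.indicator (fun _ => (2 * L * m) ^ 2) ω) := by
    intro ω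
    by_cases hω : ω ∈ A
    · rw [Set.indicator_of_mem hω]
      refine le_trans (le_trans (le_of_eq ?_) (ennreal_two_mul_le_add_sq (Z ω) (2 * L * m)))
        le_add_self
      ring
    · have : Z ω ≤ T := (hZY ω).trans (not_lt.1 hω)
      exact le_trans (by gcongr) le_self_add
  have hint := lintegral_mono (μ := P) hpt
  rw [lintegral_const_mul _ hZm, lintegral_add_left measurable_const,
    lintegral_add_left (hZm.pow_const 2), lintegral_indicator_const hAm, lintegral_const,
    measure_univ, mul_one, ← hm] at hint
  have h3 : 4 * L * m * m ≤ 4 * L * m * T + (L * (m ^ 2 + m) +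
      (2 * L * m) ^ 2 * ((4 * L)⁻¹ : ℝ≥0)) := by
    refine hint.trans ?_
    gcongr
    refine h2.trans ?_
    gcongr
    exact_mod_cast (by rw [hL]; exact le_self_add : K ≤ L)
  clear hint h2 hpt
  clear_value m
  clear hm
  lift m to ℝ≥0 using hZ
  norm_cast at h3 ⊢
  have h4 : (2 * L * m) ^ 2 * (4 * L)⁻¹ = L * m ^ 2 := by
    field_simp
    ring
  rw [h4] at h3
  by_contra hcon
  push Not at hcon
  have hm0 : 0 < m := lt_of_le_of_lt (by positivity) hcon
  rw [← NNReal.coe_le_coe] at h3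
  rw [← NNReal.coe_lt_coe] at hcon
  push_cast at h3 hcon
  have hm0' : (0 : ℝ) < m := hm0
  have hL0' : (0 : ℝ) < L := hL0
  have hT0 : (0 : ℝ) ≤ T := T.2
  have : (L : ℝ) * m * (4 * m) ≤ L * m * (4 * T + 2 * m + 1) := by nlinarith
  have := le_of_mul_le_mul_left this (by positivity)
  linarith

end SecondMoment

/-- Expand the square: off-diagonal terms are bounded by products of means, and each diagonal term
costs one additional mean. This is the bound required by `exists_bound_lintegral` with $K=1$. -/
theorem lintegral_sq_sum_le {Ω ι : Type*} [MeasurableSpace Ω] {P : Measure Ω}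
    (F : Finset ι) {X : ι → Ω → ℝ≥0∞}
    (hX : ∀ i, Measurable (X i))
    (hne : ∀ i ∈ F, ∀ j ∈ F, i ≠ j →
      ∫⁻ ω, X i ω * X j ω ∂P ≤ (∫⁻ ω, X i ω ∂P) * ∫⁻ ω, X j ω ∂P)
    (hsq : ∀ i ∈ F, ∫⁻ ω, X i ω ^ 2 ∂P ≤ (∫⁻ ω, X i ω ∂P) ^ 2 + ∫⁻ ω, X i ω ∂P) :
    ∫⁻ ω, (∑ i ∈ F, X i ω) ^ 2 ∂P ≤
      (∫⁻ ω, ∑ i ∈ F, X i ω ∂P) ^ 2 + ∫⁻ ω, ∑ i ∈ F, X i ω ∂P := by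
  classical
  have hXX : ∀ i j, Measurable fun ω => X i ω * X j ω := fun i j => (hX i).mul (hX j)
  rw [lintegral_finsetSum _ fun i _ => hX i]
  simp_rw [pow_two, Finset.sum_mul_sum]
  rw [lintegral_finsetSum F fun i _ => Finset.measurable_fun_sum F fun j _ => hXX i j,
    ← Finset.sum_add_distrib]
  refine Finset.sum_le_sum fun i hi => ?_
  rw [lintegral_finsetSum F fun j _ => hXX i j]
  calc ∑ j ∈ F, ∫⁻ ω, X i ω * X j ω ∂P
      ≤ ∑ j ∈ F, ((∫⁻ ω, X i ω ∂P) * (∫⁻ ω, X j ω ∂P) + if j = i then ∫⁻ ω, X i ω ∂P else 0) := by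
        refine Finset.sum_le_sum fun j hj => ?_
        split_ifs with h
        · subst h
          simpa [pow_two] using hsq j hj
        · simpa using hne i hi j hj (Ne.symm h)
    _ = _ := by rw [Finset.sum_add_distrib, Finset.sum_ite_eq' F i]; simp [hi]

/-! ### Truncation and conditioning -/

theorem tsum_lt_top_of_tsum_trunc {ι : Type*} {a : ι → ℝ≥0∞} (h : ∑' i, trunc (a i) < ∞)
    (ha : ∀ i, a i < ∞) : ∑' i, a i < ∞ := by
  -- Truncation changes only terms above 1. A convergent truncated series has finitely many of
  -- these, and each is finite by assumption.
  have hfin : {i | 1 ≤ trunc (a i)}.Finite :=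
    ENNReal.finite_const_le_of_tsum_ne_top h.ne one_ne_zero
  classical
  have : ∀ i, a i ≤ trunc (a i) + if i ∈ hfin.toFinset then a i else 0 := by
    intro i
    by_cases hi : 1 ≤ trunc (a i)
    · simp [hi]
    · simp only [trunc, le_min_iff, le_refl, and_true, not_le] at hi
      simp [trunc, hi.le]
  refine (ENNReal.tsum_le_tsum this).trans_lt ?_
  rw [ENNReal.tsum_add, tsum_eq_sum (f := fun i => if i ∈ hfin.toFinset then a i else 0)
    (s := hfin.toFinset) (fun i hi => if_neg hi)]
  refine ENNReal.add_lt_top.2 ⟨h, ENNReal.sum_lt_top.2 fun i hi => ?_⟩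
  rw [if_pos hi]
  exact ha i

theorem trunc_le_self (a : ℝ≥0∞) : trunc a ≤ a := min_le_left _ _

theorem trunc_le_one (a : ℝ≥0∞) : trunc a ≤ 1 := min_le_right _ _

theorem measurable_trunc : Measurable trunc := measurable_id.min measurable_const

theorem tsum_lt_top_iff_tsum_trunc {ι : Type*} {a : ι → ℝ≥0∞} :
    ∑' i, a i < ∞ ↔ ∑' i, trunc (a i) < ∞ ∧ ∀ i, a i < ∞ :=
  ⟨fun h => ⟨(ENNReal.tsum_le_tsum fun _ => trunc_le_self _).trans_lt h,
    fun i => (ENNReal.le_tsum i).trans_lt h⟩, fun h => tsum_lt_top_of_tsum_trunc h.1 h.2⟩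

/-- The joint law is a product, so Fubini allows `v` to be frozen. With `v` the vertex process, the
stars or labels become independent variables inserted into deterministic functions. -/
theorem ae_lt_top_iff_of_indepFun {Ω α β : Type*} [MeasurableSpace Ω] [MeasurableSpace α]
    [MeasurableSpace β] {P : Measure Ω} [IsProbabilityMeasure P] {v : Ω → α} {w : Ω → β}
    (hv : Measurable v) (hw : Measurable w) (h : IndepFun v w P) {F : α × β → ℝ≥0∞}
    (hF : Measurable F) :
    (∀ᵐ ω ∂P, F (v ω, w ω) < ∞) ↔ ∀ᵐ ω ∂P, ∀ᵐ ω' ∂P, F (v ω, w ω') < ∞ := by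
  have hS : MeasurableSet {p | F p < ∞} := measurableSet_lt hF measurable_const
  have : IsProbabilityMeasure (P.map v) := Measure.isProbabilityMeasure_map hv.aemeasurable
  have : IsProbabilityMeasure (P.map w) := Measure.isProbabilityMeasure_map hw.aemeasurable
  rw [← ae_map_iff (f := fun ω => (v ω, w ω)) (p := fun p => F p < ∞)
      (hv.prodMk hw).aemeasurable hS,
    h.map_prod_eq_prod_map_map hv.aemeasurable hw.aemeasurable,
    Measure.ae_prod_iff_ae_ae hS, ae_map_iff hv.aemeasurable]
  · refine Filter.eventually_congr (.of_forall fun ω => ?_)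
    rw [ae_map_iff hw.aemeasurable (measurableSet_lt (by fun_prop) measurable_const)]
  · simp_rw [ae_iff]
    exact measurableSet_eq_fun (measurable_measure_prodMk_left hS.compl) measurable_const

/-! ### Poisson moments and intensity measures -/

theorem lintegral_poissonMeasure_mul (r : ℝ≥0) (g : ℕ → ℝ≥0∞) :
    ∫⁻ n, n * g n ∂(poissonMeasure r) = r * ∫⁻ n, g (n + 1) ∂(poissonMeasure r) := by
  have key : ∀ G : ℕ → ℝ≥0∞, ∫⁻ n, G n ∂(poissonMeasure r) =
      ∑' n, G n * ENNReal.ofReal (Real.exp (-r) * r ^ n / n.factorial) := by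
    intro G
    rw [lintegral_countable']
    simp_rw [poissonMeasure_singleton]
  rw [key, key, tsum_eq_zero_add' ENNReal.summable, ← ENNReal.tsum_mul_left]
  simp only [CharP.cast_eq_zero, zero_mul, zero_add]
  refine tsum_congr fun n => ?_
  have : ((n + 1 : ℕ) : ℝ≥0∞) * ENNReal.ofReal (Real.exp (-r) * r ^ (n + 1) / (n + 1).factorial) =
      r * ENNReal.ofReal (Real.exp (-r) * r ^ n / n.factorial) := by
    rw [← ENNReal.ofReal_natCast, ← ENNReal.ofReal_coe_nnreal, ← ENNReal.ofReal_mul (by positivity),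
      ← ENNReal.ofReal_mul (by positivity)]
    congr 1
    rw [Nat.factorial_succ]
    push_cast
    field_simp
    ring
  calc _ = g (n + 1) * (((n + 1 : ℕ) : ℝ≥0∞) *
        ENNReal.ofReal (Real.exp (-r) * r ^ (n + 1) / (n + 1).factorial)) := by ring
    _ = _ := by rw [this]; ring

theorem lintegral_poissonMeasure_id (r : ℝ≥0) : ∫⁻ n : ℕ, (n : ℝ≥0∞) ∂(poissonMeasure r) = r := by
  simpa using lintegral_poissonMeasure_mul r 1

theorem lintegral_poissonMeasure_sq (r : ℝ≥0) :
    ∫⁻ n : ℕ, (n : ℝ≥0∞) ^ 2 ∂(poissonMeasure r) = (r : ℝ≥0∞) ^ 2 + r := by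
  have := lintegral_poissonMeasure_mul r (fun n => n)
  simp_rw [← pow_two] at this
  rw [this]
  simp only [Nat.cast_add, Nat.cast_one]
  rw [lintegral_add_right _ measurable_const, lintegral_poissonMeasure_id]
  simp
  ring

/-- The intensity measure of a countable family of random points. -/
noncomputable def intensity {Ω E ι : Type*} [MeasurableSpace Ω] [MeasurableSpace E] (P : Measure Ω)
    (Z : ι → Ω → E) : Measure E :=
  Measure.sum fun i => P.map (Z i)

theorem lintegral_intensity {Ω E ι : Type*} [MeasurableSpace Ω] [MeasurableSpace E] [Countable ι]
    {P : Measure Ω} {Z : ι → Ω → E} (hZ : ∀ i, Measurable (Z i)) {F : E → ℝ≥0∞}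
    (hF : Measurable F) : ∫⁻ x, F x ∂(intensity P Z) = ∫⁻ ω, ∑' i, F (Z i ω) ∂P := by
  rw [intensity, lintegral_sum_measure,
    lintegral_tsum (f := fun i ω => F (Z i ω)) fun i => (hF.comp (hZ i)).aemeasurable]
  exact tsum_congr fun i => lintegral_map hF (hZ i)

theorem intensity_apply {Ω E ι : Type*} [MeasurableSpace Ω] [MeasurableSpace E] [Countable ι]
    {P : Measure Ω} {Z : ι → Ω → E} (hZ : ∀ i, Measurable (Z i)) {B : Set E}
    (hB : MeasurableSet B) :
    intensity P Z B = ∫⁻ ω, ∑' i, B.indicator (1 : E → ℝ≥0∞) (Z i ω) ∂P := by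
  rw [← lintegral_intensity hZ (measurable_one.indicator hB), lintegral_indicator_one hB]

theorem pointMeasure_apply {Ω E : Type*} [MeasurableSpace E] (X : ℕ → Ω → E) (ω : Ω) {B : Set E}
    (hB : MeasurableSet B) :
    pointMeasure X ω B = ∑' j, B.indicator (1 : E → ℝ≥0∞) (X j ω) := by
  simp [pointMeasure, Measure.sum_apply _ hB, Measure.dirac_apply' _ hB]

/-- Extend one pair of factors at a time: with a measurable rectangle fixed on the other side, the
projected restrictions are finite measures that agree on rectangles, hence agree. -/
theorem ext_prod_prod {α β γ δ : Type*} [MeasurableSpace α] [MeasurableSpace β]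
    [MeasurableSpace γ] [MeasurableSpace δ] {μ ν : Measure ((α × β) × γ × δ)} [IsFiniteMeasure μ]
    [IsFiniteMeasure ν]
    (h : ∀ s t u v, MeasurableSet s → MeasurableSet t → MeasurableSet u → MeasurableSet v →
      μ ((s ×ˢ t) ×ˢ (u ×ˢ v)) = ν ((s ×ˢ t) ×ˢ (u ×ˢ v))) : μ = ν := by
  have h1 : ∀ (s : Set α) (t : Set β) (w : Set (γ × δ)), MeasurableSet s → MeasurableSet t →
      MeasurableSet w → μ ((s ×ˢ t) ×ˢ w) = ν ((s ×ˢ t) ×ˢ w) := by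
    intro s t w hs ht hw
    have key : (μ.restrict ((s ×ˢ t) ×ˢ Set.univ)).map Prod.snd =
        (ν.restrict ((s ×ˢ t) ×ˢ Set.univ)).map Prod.snd := by
      refine Measure.ext_prod fun {u v} hu hv => ?_
      rw [Measure.map_apply measurable_snd (hu.prod hv), Measure.map_apply measurable_snd
        (hu.prod hv), Measure.restrict_apply (measurable_snd (hu.prod hv)),
        Measure.restrict_apply (measurable_snd (hu.prod hv))]
      convert! h s t u v hs ht hu hv using 2 <;> ext <;> simp <;> tauto
    have := congrArg (fun m => m w) key
    simp only [Measure.map_apply measurable_snd hw, Measure.restrict_apply (measurable_snd hw)]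
      at this
    convert! this using 2 <;> ext <;> simp <;> tauto
  refine Measure.ext_prod fun {z w} hz hw => ?_
  have key : (μ.restrict (Set.univ ×ˢ w)).map Prod.fst =
      (ν.restrict (Set.univ ×ˢ w)).map Prod.fst := by
    refine Measure.ext_prod fun {s t} hs ht => ?_
    rw [Measure.map_apply measurable_fst (hs.prod ht), Measure.map_apply measurable_fst
      (hs.prod ht), Measure.restrict_apply (measurable_fst (hs.prod ht)),
      Measure.restrict_apply (measurable_fst (hs.prod ht))]
    convert! h1 s t w hs ht hw using 2 <;> ext <;> simp
  have := congrArg (fun m => m z) key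
  simp only [Measure.map_apply measurable_fst hz, Measure.restrict_apply (measurable_fst hz)]
    at this
  convert! this using 2 <;> ext <;> simp

/-- Poisson independence is postulated only for disjoint sets. Overlapping `A`, `A'` and `B`, `B'`
must first be split into these six atoms. -/
theorem pairwise_disjoint_atoms {E : Type*} {R R' A A' B B' : Set E} (hRR' : Disjoint R R')
    (hAR : A ⊆ R) (hAR' : A' ⊆ R) (hBR : B ⊆ R') (hBR' : B' ⊆ R') :
    Pairwise fun i j => Disjoint (![A ∩ A', A \ A', A' \ A, B ∩ B', B \ B', B' \ B] i)
      (![A ∩ A', A \ A', A' \ A, B ∩ B', B \ B', B' \ B] j) := by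
  have hRR : ∀ x, x ∈ R → x ∈ R' → False := fun x h1 h2 => Set.disjoint_left.1 hRR' h1 h2
  intro i j hij
  refine Set.disjoint_left.2 fun x hx hx' => ?_
  have a1 := @hAR x
  have a2 := @hAR' x
  have a3 := @hBR x
  have a4 := @hBR' x
  have a5 := hRR x
  fin_cases i <;> fin_cases j <;> first | exact absurd rfl hij | (
    simp only [Fin.mk_zero, Fin.mk_one, Fin.reduceFinMk, Matrix.cons_val,
      Matrix.cons_val_zero, Matrix.cons_val_one, Set.mem_inter_iff, Set.mem_sdiff] at hx hx'
    tauto)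

theorem tsum_indicator_prod {Ω E : Type*} [MeasurableSpace E] (X : ℕ → Ω → E) (ω : Ω)
    {A B : Set E} (hA : MeasurableSet A) (hB : MeasurableSet B) :
    ∑' p : ℕ × ℕ, (A ×ˢ B).indicator (1 : E × E → ℝ≥0∞) (X p.1 ω, X p.2 ω) =
      pointMeasure X ω A * pointMeasure X ω B := by
  rw [pointMeasure_apply X ω hA, pointMeasure_apply X ω hB, ENNReal.tsum_prod',
    ← ENNReal.tsum_mul_right]
  refine tsum_congr fun i => ?_
  rw [← ENNReal.tsum_mul_left]
  refine tsum_congr fun j => ?_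
  simp only [Set.indicator, Set.mem_prod, Pi.one_apply]
  split_ifs <;> simp_all

/-! ### Moment formulas for Poisson processes -/

namespace IsPoissonProcess

variable {Ω E : Type*} [MeasurableSpace Ω] [MeasurableSpace E] {P : Measure Ω}
  {μ : Measure E} {X : ℕ → Ω → E}

theorem measurable_count (hX : IsPoissonProcess P μ X) {B : Set E} (hB : MeasurableSet B) :
    Measurable fun ω => pointMeasure X ω B := by
  simp_rw [pointMeasure_apply X _ hB]
  exact Measurable.tsum fun j => (measurable_one.indicator hB).comp (hX.measurable j)

theorem lintegral_count_comp (hX : IsPoissonProcess P μ X) {B : Set E} (hB : MeasurableSet B)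
    {r : ℝ≥0} (hr : μ B = r) {G : ℝ≥0∞ → ℝ≥0∞} (hG : Measurable G) :
    ∫⁻ ω, G (pointMeasure X ω B) ∂P = ∫⁻ n : ℕ, G n ∂(poissonMeasure r) := by
  rw [(hX.hasLaw_count B hB r hr).lintegral_comp hG.aemeasurable,
    lintegral_map hG (measurable_of_countable _)]

theorem lintegral_count (hX : IsPoissonProcess P μ X) {B : Set E} (hB : MeasurableSet B)
    (hfin : μ B ≠ ∞) : ∫⁻ ω, pointMeasure X ω B ∂P = μ B := by
  lift μ B to ℝ≥0 using hfin with r hr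
  exact (hX.lintegral_count_comp hB hr.symm measurable_id (G := id)).trans
    (lintegral_poissonMeasure_id r)

theorem lintegral_count_sq (hX : IsPoissonProcess P μ X) {B : Set E} (hB : MeasurableSet B)
    (hfin : μ B ≠ ∞) : ∫⁻ ω, pointMeasure X ω B ^ 2 ∂P = μ B ^ 2 + μ B := by
  lift μ B to ℝ≥0 using hfin with r hr
  exact (hX.lintegral_count_comp hB hr.symm (measurable_id.pow_const 2)
    (G := fun x => x ^ 2)).trans (lintegral_poissonMeasure_sq r)

theorem lintegral_count_mul_of_disjoint (hX : IsPoissonProcess P μ X) {A B : Set E}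
    (hA : MeasurableSet A) (hB : MeasurableSet B) (hAB : Disjoint A B) (hfA : μ A ≠ ∞)
    (hfB : μ B ≠ ∞) : ∫⁻ ω, pointMeasure X ω A * pointMeasure X ω B ∂P = μ A * μ B := by
  have h := hX.indep_count 2 ![A, B] (by simp [Fin.forall_fin_two, hA, hB]) (by
    intro i j hij
    fin_cases i <;> fin_cases j <;> simp_all [disjoint_comm])
  have h01 : IndepFun (fun ω => pointMeasure X ω A) (fun ω => pointMeasure X ω B) P :=
    h.indepFun (i := 0) (j := 1) (by simp)
  have := lintegral_mul_eq_lintegral_mul_lintegral_of_indepFun (hX.measurable_count hA)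
    (hX.measurable_count hB) h01
  simp only [Pi.mul_apply] at this
  rw [this, hX.lintegral_count hA hfA, hX.lintegral_count hB hfB]

/-- Split both sets along their intersection. Disjoint counts are uncorrelated, and the variance of
the common count produces `μ (A ∩ B)`. -/
theorem lintegral_count_mul (hX : IsPoissonProcess P μ X) {A B : Set E}
    (hA : MeasurableSet A) (hB : MeasurableSet B) (hfA : μ A ≠ ∞) (hfB : μ B ≠ ∞) :
    ∫⁻ ω, pointMeasure X ω A * pointMeasure X ω B ∂P = μ A * μ B + μ (A ∩ B) := by
  have hC := hA.inter hB
  have hA' := hA.diff hB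
  have hB' := hB.diff hA
  have hfC : μ (A ∩ B) ≠ ∞ := measure_ne_top_of_subset Set.inter_subset_left hfA
  have hfA' : μ (A \ B) ≠ ∞ := measure_ne_top_of_subset Set.sdiff_subset hfA
  have hfB' : μ (B \ A) ≠ ∞ := measure_ne_top_of_subset Set.sdiff_subset hfB
  have hCB' : Disjoint (A ∩ B) (B \ A) := by
    rw [Set.inter_comm]; exact Set.disjoint_sdiff_inter.symm
  have hA'C : Disjoint (A \ B) (A ∩ B) := Set.disjoint_sdiff_inter
  have hA'B' : Disjoint (A \ B) (B \ A) :=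
    Set.disjoint_left.2 fun x hx hx' => hx'.2 hx.1
  have eA : ∀ m : Measure E, m A = m (A ∩ B) + m (A \ B) := fun m =>
    (measure_inter_add_sdiff A hB).symm
  have eB : ∀ m : Measure E, m B = m (A ∩ B) + m (B \ A) := fun m => by
    rw [Set.inter_comm]; exact (measure_inter_add_sdiff B hA).symm
  have e : ∀ ω, pointMeasure X ω A * pointMeasure X ω B =
      pointMeasure X ω (A ∩ B) ^ 2 + pointMeasure X ω (A ∩ B) * pointMeasure X ω (B \ A) +
      (pointMeasure X ω (A \ B) * pointMeasure X ω (A ∩ B) +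
        pointMeasure X ω (A \ B) * pointMeasure X ω (B \ A)) := fun ω => by
    rw [eA (pointMeasure X ω), eB (pointMeasure X ω)]; ring
  have mC := hX.measurable_count hC
  have mA := hX.measurable_count hA'
  have mB := hX.measurable_count hB'
  simp_rw [e]
  rw [lintegral_add_left (by fun_prop), lintegral_add_left (by fun_prop),
    lintegral_add_left (by fun_prop), hX.lintegral_count_sq hC hfC,
    hX.lintegral_count_mul_of_disjoint hC hB' hCB' hfC hfB',
    hX.lintegral_count_mul_of_disjoint hA' hC hA'C hfA' hfC,
    hX.lintegral_count_mul_of_disjoint hA' hB' hA'B' hfA' hfB', eA μ, eB μ]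
  ring

/-- The two products are functions of disjoint triples of atom counts, hence independent; no
finiteness of the measures is needed. -/
theorem lintegral_count_mul_mul (hX : IsPoissonProcess P μ X) {R R' A A' B B' : Set E}
    (hRR' : Disjoint R R') (hA : MeasurableSet A) (hA' : MeasurableSet A') (hB : MeasurableSet B)
    (hB' : MeasurableSet B') (hAR : A ⊆ R) (hAR' : A' ⊆ R) (hBR : B ⊆ R') (hBR' : B' ⊆ R') :
    ∫⁻ ω, (pointMeasure X ω A * pointMeasure X ω A') *
        (pointMeasure X ω B * pointMeasure X ω B') ∂P =
      (∫⁻ ω, pointMeasure X ω A * pointMeasure X ω A' ∂P) *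
        ∫⁻ ω, pointMeasure X ω B * pointMeasure X ω B' ∂P := by
  have h := hX.indep_count 6 ![A ∩ A', A \ A', A' \ A, B ∩ B', B \ B', B' \ B] (by
    intro i
    fin_cases i
    exacts [hA.inter hA', hA.diff hA', hA'.diff hA, hB.inter hB', hB.diff hB', hB'.diff hB])
    (pairwise_disjoint_atoms hRR' hAR hAR' hBR hBR')
  have hm : ∀ i, Measurable fun ω => pointMeasure X ω
      (![A ∩ A', A \ A', A' \ A, B ∩ B', B \ B', B' \ B] i) := by
    intro i
    fin_cases i
    exacts [hX.measurable_count (hA.inter hA'), hX.measurable_count (hA.diff hA'),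
      hX.measurable_count (hA'.diff hA), hX.measurable_count (hB.inter hB'),
      hX.measurable_count (hB.diff hB'), hX.measurable_count (hB'.diff hB)]
  have h2 := h.indepFun_finset {0, 1, 2} {3, 4, 5} (by decide) hm
  have h3 := h2.comp
    (φ := fun x : ({0, 1, 2} : Finset (Fin 6)) → ℝ≥0∞ =>
      (x ⟨0, by simp⟩ + x ⟨1, by simp⟩) * (x ⟨0, by simp⟩ + x ⟨2, by simp⟩))
    (ψ := fun x : ({3, 4, 5} : Finset (Fin 6)) → ℝ≥0∞ =>
      (x ⟨3, by simp⟩ + x ⟨4, by simp⟩) * (x ⟨3, by simp⟩ + x ⟨5, by simp⟩))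
    (by fun_prop) (by fun_prop)
  have e : ∀ (A A' : Set E), MeasurableSet A → MeasurableSet A' → ∀ m : Measure E,
      (m (A ∩ A') + m (A \ A')) * (m (A ∩ A') + m (A' \ A)) = m A * m A' := by
    intro A A' hA hA' m
    rw [measure_inter_add_sdiff A hA', Set.inter_comm, measure_inter_add_sdiff A' hA]
  have h4 : IndepFun (fun ω => pointMeasure X ω A * pointMeasure X ω A')
      (fun ω => pointMeasure X ω B * pointMeasure X ω B') P := by
    simp_rw [← e A A' hA hA', ← e B B' hB hB']
    exact h3
  exact lintegral_mul_eq_lintegral_mul_lintegral_of_indepFun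
    ((hX.measurable_count hA).mul (hX.measurable_count hA'))
    ((hX.measurable_count hB).mul (hX.measurable_count hB')) h4

theorem measurable_pair (hX : IsPoissonProcess P μ X) (p : ℕ × ℕ) :
    Measurable fun ω => (X p.1 ω, X p.2 ω) :=
  (hX.measurable _).prodMk (hX.measurable _)

theorem measurable_quadruple (hX : IsPoissonProcess P μ X) (p : (ℕ × ℕ) × ℕ × ℕ) :
    Measurable fun ω => ((X p.1.1 ω, X p.1.2 ω), (X p.2.1 ω, X p.2.2 ω)) :=
  (hX.measurable_pair _).prodMk (hX.measurable_pair _)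

theorem intensity_pair_prod (hX : IsPoissonProcess P μ X) {A B : Set E} (hA : MeasurableSet A)
    (hB : MeasurableSet B) :
    intensity P (fun (p : ℕ × ℕ) ω => (X p.1 ω, X p.2 ω)) (A ×ˢ B) =
      ∫⁻ ω, pointMeasure X ω A * pointMeasure X ω B ∂P := by
  rw [intensity_apply hX.measurable_pair (hA.prod hB)]
  simp_rw [tsum_indicator_prod X _ hA hB]

theorem intensity_quadruple_prod (hX : IsPoissonProcess P μ X) {A A' B B' : Set E}
    (hA : MeasurableSet A) (hA' : MeasurableSet A') (hB : MeasurableSet B)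
    (hB' : MeasurableSet B') :
    intensity P (fun (p : (ℕ × ℕ) × ℕ × ℕ) ω => ((X p.1.1 ω, X p.1.2 ω), (X p.2.1 ω, X p.2.2 ω)))
        ((A ×ˢ A') ×ˢ (B ×ˢ B')) =
      ∫⁻ ω, (pointMeasure X ω A * pointMeasure X ω A') *
        (pointMeasure X ω B * pointMeasure X ω B') ∂P := by
  rw [intensity_apply hX.measurable_quadruple ((hA.prod hA').prod (hB.prod hB'))]
  refine lintegral_congr fun ω => ?_
  rw [← tsum_indicator_prod X _ hA hA', ← tsum_indicator_prod X _ hB hB', ENNReal.tsum_prod',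
    ← ENNReal.tsum_mul_right]
  refine tsum_congr fun i => ?_
  rw [← ENNReal.tsum_mul_left]
  refine tsum_congr fun j => ?_
  simp only [Set.indicator, Set.mem_prod, Pi.one_apply]
  split_ifs <;> simp_all

theorem intensity_eq [SigmaFinite μ] (hX : IsPoissonProcess P μ X) : intensity P X = μ := by
  refine (Measure.ext_iff_of_iUnion_eq_univ (iUnion_spanningSets μ)).2 fun n => ?_
  refine Measure.ext fun B hB => ?_
  rw [Measure.restrict_apply hB, Measure.restrict_apply hB,
    intensity_apply hX.measurable (hB.inter (measurableSet_spanningSets μ n)),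
    ← hX.lintegral_count (hB.inter (measurableSet_spanningSets μ n))
      (measure_ne_top_of_subset Set.inter_subset_right (measure_spanningSets_lt_top μ n).ne)]
  simp_rw [pointMeasure_apply X _ (hB.inter (measurableSet_spanningSets μ n))]

/-- Campbell's formula. -/
theorem lintegral_tsum [SigmaFinite μ] (hX : IsPoissonProcess P μ X) {φ : E → ℝ≥0∞}
    (hφ : Measurable φ) : ∫⁻ ω, ∑' j, φ (X j ω) ∂P = ∫⁻ x, φ x ∂μ := by
  rw [← lintegral_intensity hX.measurable hφ, hX.intensity_eq]

/-- The mixed second moments of the counts give the values on rectangles, which determine the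
measure along an exhaustion by squares. The diagonal part is due to the pairs $i=j$. -/
theorem intensity_pair_eq [SigmaFinite μ] (hX : IsPoissonProcess P μ X) :
    intensity P (fun (p : ℕ × ℕ) ω => (X p.1 ω, X p.2 ω)) =
      μ.prod μ + μ.map (fun x => (x, x)) := by
  have hS := measurableSet_spanningSets μ
  have hfS := measure_spanningSets_lt_top μ
  have hdiag : Measurable fun x : E => (x, x) := measurable_id.prodMk measurable_id
  have hval : ∀ A B : Set E, MeasurableSet A → MeasurableSet B → μ A ≠ ∞ → μ B ≠ ∞ →
      intensity P (fun (p : ℕ × ℕ) ω => (X p.1 ω, X p.2 ω)) (A ×ˢ B) =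
        (μ.prod μ + μ.map (fun x => (x, x))) (A ×ˢ B) := by
    intro A B hA hB hfA hfB
    rw [hX.intensity_pair_prod hA hB, hX.lintegral_count_mul hA hB hfA hfB, Measure.add_apply,
      Measure.prod_prod, Measure.map_apply hdiag (hA.prod hB)]
    rfl
  have hU : ⋃ n, spanningSets μ n ×ˢ spanningSets μ n = (Set.univ : Set (E × E)) := by
    rw [Set.iUnion_prod_of_monotone (monotone_spanningSets μ) (monotone_spanningSets μ),
      iUnion_spanningSets, Set.univ_prod_univ]
  refine (Measure.ext_iff_of_iUnion_eq_univ hU).2 fun n => ?_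
  have hfin : IsFiniteMeasure ((intensity P (fun (p : ℕ × ℕ) ω => (X p.1 ω, X p.2 ω))).restrict
      (spanningSets μ n ×ˢ spanningSets μ n)) := by
    refine ⟨?_⟩
    rw [Measure.restrict_apply_univ, hX.intensity_pair_prod (hS n) (hS n),
      hX.lintegral_count_mul (hS n) (hS n) (hfS n).ne (hfS n).ne, Set.inter_self]
    exact ENNReal.add_lt_top.2 ⟨ENNReal.mul_lt_top (hfS n) (hfS n), hfS n⟩
  refine Measure.ext_prod fun {A B} hA hB => ?_
  rw [Measure.restrict_apply (hA.prod hB), Measure.restrict_apply (hA.prod hB), Set.prod_inter_prod]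
  exact hval _ _ (hA.inter (hS n)) (hB.inter (hS n))
    (measure_ne_top_of_subset Set.inter_subset_right (hfS n).ne)
    (measure_ne_top_of_subset Set.inter_subset_right (hfS n).ne)

theorem lintegral_intensity_pair [SigmaFinite μ] (hX : IsPoissonProcess P μ X)
    {F : E × E → ℝ≥0∞} (hF : Measurable F) :
    ∫⁻ q, F q ∂(intensity P (fun (p : ℕ × ℕ) ω => (X p.1 ω, X p.2 ω))) =
      ∫⁻ x, ∫⁻ y, F (x, y) ∂μ ∂μ + ∫⁻ x, F (x, x) ∂μ := by
  rw [hX.intensity_pair_eq, lintegral_add_measure, lintegral_prod _ hF.aemeasurable,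
    lintegral_map hF (by fun_prop : Measurable fun x : E => (x, x))]

theorem lintegral_tsum_pair [SigmaFinite μ] (hX : IsPoissonProcess P μ X)
    {F : E × E → ℝ≥0∞} (hF : Measurable F) :
    ∫⁻ ω, ∑' p : ℕ × ℕ, F (X p.1 ω, X p.2 ω) ∂P =
      ∫⁻ x, ∫⁻ y, F (x, y) ∂μ ∂μ + ∫⁻ x, F (x, x) ∂μ := by
  rw [← hX.lintegral_intensity_pair hF, lintegral_intensity hX.measurable_pair hF]

/-- Two points in `R` and two in a disjoint `R'` have independent pair counts. The four-point
intensity therefore factors into two pair intensities, and the general fourth moment formula with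
its many diagonals is avoided. -/
theorem intensity_quadruple_restrict [SigmaFinite μ] (hX : IsPoissonProcess P μ X) {R R' : Set E}
    (hR : MeasurableSet R) (hR' : MeasurableSet R') (hRR' : Disjoint R R') (hfR : μ R ≠ ∞)
    (hfR' : μ R' ≠ ∞) :
    (intensity P (fun (p : (ℕ × ℕ) × ℕ × ℕ) ω =>
        ((X p.1.1 ω, X p.1.2 ω), (X p.2.1 ω, X p.2.2 ω)))).restrict ((R ×ˢ R) ×ˢ (R' ×ˢ R')) =
      ((intensity P (fun (p : ℕ × ℕ) ω => (X p.1 ω, X p.2 ω))).restrict (R ×ˢ R)).prod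
        ((intensity P (fun (p : ℕ × ℕ) ω => (X p.1 ω, X p.2 ω))).restrict (R' ×ˢ R')) := by
  have hfin : ∀ {S : Set E}, MeasurableSet S → μ S ≠ ∞ →
      IsFiniteMeasure ((intensity P (fun (p : ℕ × ℕ) ω => (X p.1 ω, X p.2 ω))).restrict
        (S ×ˢ S)) := by
    intro S hS hfS
    refine ⟨?_⟩
    rw [Measure.restrict_apply_univ, hX.intensity_pair_prod hS hS,
      hX.lintegral_count_mul hS hS hfS hfS, Set.inter_self]
    exact ENNReal.add_lt_top.2 ⟨ENNReal.mul_lt_top hfS.lt_top hfS.lt_top, hfS.lt_top⟩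
  have i1 := hfin hR hfR
  have i2 := hfin hR' hfR'
  have hval : ∀ A A' B B' : Set E, MeasurableSet A → MeasurableSet A' → MeasurableSet B →
      MeasurableSet B' → (intensity P (fun (p : (ℕ × ℕ) × ℕ × ℕ) ω =>
        ((X p.1.1 ω, X p.1.2 ω), (X p.2.1 ω, X p.2.2 ω)))).restrict ((R ×ˢ R) ×ˢ (R' ×ˢ R'))
          ((A ×ˢ A') ×ˢ (B ×ˢ B')) =
      ((intensity P (fun (p : ℕ × ℕ) ω => (X p.1 ω, X p.2 ω))).restrict (R ×ˢ R)).prod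
        ((intensity P (fun (p : ℕ × ℕ) ω => (X p.1 ω, X p.2 ω))).restrict (R' ×ˢ R'))
          ((A ×ˢ A') ×ˢ (B ×ˢ B')) := by
    intro A A' B B' hA hA' hB hB'
    rw [Measure.restrict_apply ((hA.prod hA').prod (hB.prod hB')), Set.prod_inter_prod,
      Set.prod_inter_prod, Set.prod_inter_prod, Measure.prod_prod,
      Measure.restrict_apply (hA.prod hA'), Measure.restrict_apply (hB.prod hB'),
      Set.prod_inter_prod, Set.prod_inter_prod,
      hX.intensity_quadruple_prod (hA.inter hR) (hA'.inter hR) (hB.inter hR') (hB'.inter hR'),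
      hX.intensity_pair_prod (hA.inter hR) (hA'.inter hR),
      hX.intensity_pair_prod (hB.inter hR') (hB'.inter hR')]
    exact hX.lintegral_count_mul_mul hRR' (hA.inter hR) (hA'.inter hR) (hB.inter hR')
      (hB'.inter hR') Set.inter_subset_right Set.inter_subset_right Set.inter_subset_right
      Set.inter_subset_right
  have i3 : IsFiniteMeasure ((intensity P (fun (p : (ℕ × ℕ) × ℕ × ℕ) ω =>
      ((X p.1.1 ω, X p.1.2 ω), (X p.2.1 ω, X p.2.2 ω)))).restrict
        ((R ×ˢ R) ×ˢ (R' ×ˢ R'))) := by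
    refine ⟨?_⟩
    have := hval Set.univ Set.univ Set.univ Set.univ .univ .univ .univ .univ
    simp only [Set.univ_prod_univ] at this
    rw [this]
    exact measure_lt_top _ _
  exact ext_prod_prod fun s t u v hs ht hu hv => hval s t u v hs ht hu hv

/-- The second moment of a double Poisson integral over a product of disjoint sets. -/
theorem lintegral_sq_tsum_pair_le [SigmaFinite μ] (hX : IsPoissonProcess P μ X) {R R' : Set E}
    (hR : MeasurableSet R) (hR' : MeasurableSet R') (hRR' : Disjoint R R') (hfR : μ R ≠ ∞)
    (hfR' : μ R' ≠ ∞) {ψ : E × E → ℝ≥0∞} (hψ : Measurable ψ)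
    (hsupp : ∀ q, q ∉ R ×ˢ R' → ψ q = 0) :
    ∫⁻ ω, (∑' p : ℕ × ℕ, ψ (X p.1 ω, X p.2 ω)) ^ 2 ∂P ≤
      (∫⁻ x, ∫⁻ y, ψ (x, y) ∂μ ∂μ) ^ 2 + ∫⁻ x, (∫⁻ y, ψ (x, y) ∂μ) ^ 2 ∂μ +
        (∫⁻ y, (∫⁻ x, ψ (x, y) ∂μ) ^ 2 ∂μ + ∫⁻ x, ∫⁻ y, ψ (x, y) ^ 2 ∂μ ∂μ) := by
  -- The coordinates are regrouped: the first pair holds the two points in `R`, the second the two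
  -- points in `R'`. This is the form in which the intensity factors.
  set G : (E × E) × E × E → ℝ≥0∞ := fun q => ψ (q.1.1, q.2.1) * ψ (q.1.2, q.2.2) with hG
  have hGm : Measurable G := by fun_prop
  have hψ1 : Measurable fun x => ∫⁻ y, ψ (x, y) ∂μ := hψ.lintegral_prod_right'
  have hGsupp : ∀ q, q ∉ (R ×ˢ R) ×ˢ (R' ×ˢ R') → G q = 0 := by
    intro q hq
    by_cases h1 : (q.1.1, q.2.1) ∈ R ×ˢ R'
    · by_cases h2 : (q.1.2, q.2.2) ∈ R ×ˢ R'
      · exact absurd ⟨⟨h1.1, h2.1⟩, h1.2, h2.2⟩ hq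
      · simp [hG, hsupp _ h2]
    · simp [hG, hsupp _ h1]
  have hRm := (hR.prod hR).prod (hR'.prod hR')
  have e1 : ∫⁻ ω, (∑' p : ℕ × ℕ, ψ (X p.1 ω, X p.2 ω)) ^ 2 ∂P =
      ∫⁻ q, G q ∂(intensity P (fun (p : (ℕ × ℕ) × ℕ × ℕ) ω =>
        ((X p.1.1 ω, X p.1.2 ω), (X p.2.1 ω, X p.2.2 ω)))) := by
    rw [lintegral_intensity hX.measurable_quadruple hGm]
    refine lintegral_congr fun ω => ?_
    rw [pow_two, ← ENNReal.tsum_mul_right]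
    simp_rw [← ENNReal.tsum_mul_left]
    rw [← ENNReal.tsum_prod' (f := fun p : (ℕ × ℕ) × ℕ × ℕ =>
      ψ (X p.1.1 ω, X p.1.2 ω) * ψ (X p.2.1 ω, X p.2.2 ω)),
      ← (Equiv.prodProdProdComm ℕ ℕ ℕ ℕ).tsum_eq]
    rfl
  have e2 : ∫⁻ q, G q ∂(intensity P (fun (p : (ℕ × ℕ) × ℕ × ℕ) ω =>
        ((X p.1.1 ω, X p.1.2 ω), (X p.2.1 ω, X p.2.2 ω)))) =
      ∫⁻ q, G q ∂((intensity P (fun (p : (ℕ × ℕ) × ℕ × ℕ) ω =>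
        ((X p.1.1 ω, X p.1.2 ω), (X p.2.1 ω, X p.2.2 ω)))).restrict
          ((R ×ˢ R) ×ˢ (R' ×ˢ R'))) := by
    rw [← lintegral_indicator hRm]
    refine lintegral_congr fun q => ?_
    by_cases hq : q ∈ (R ×ˢ R) ×ˢ (R' ×ˢ R')
    · rw [Set.indicator_of_mem hq]
    · rw [Set.indicator_of_notMem hq, hGsupp q hq]
  have i2 : SFinite (intensity P (fun (p : ℕ × ℕ) ω => (X p.1 ω, X p.2 ω))) := by
    rw [hX.intensity_pair_eq]; infer_instance
  have inner : ∀ q : E × E, ∫⁻ q', G (q, q') ∂(intensity P (fun (p : ℕ × ℕ) ω =>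
      (X p.1 ω, X p.2 ω))) = (∫⁻ y, ψ (q.1, y) ∂μ) * (∫⁻ y, ψ (q.2, y) ∂μ) +
        ∫⁻ y, ψ (q.1, y) * ψ (q.2, y) ∂μ := by
    intro q
    rw [hX.lintegral_intensity_pair (by fun_prop)]
    simp only [hG]
    congr 1
    rw [← lintegral_mul_const _ (by fun_prop)]
    exact lintegral_congr fun y => lintegral_const_mul _ (by fun_prop)
  rw [e1, e2, hX.intensity_quadruple_restrict hR hR' hRR' hfR hfR',
    lintegral_prod _ hGm.aemeasurable]
  -- Each pair intensity is a product part plus a diagonal part; the four combinations are the four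
  -- terms of the bound.
  calc _ ≤ ∫⁻ q, ∫⁻ q', G (q, q') ∂(intensity P (fun (p : ℕ × ℕ) ω => (X p.1 ω, X p.2 ω)))
        ∂(intensity P (fun (p : ℕ × ℕ) ω => (X p.1 ω, X p.2 ω))) :=
        lintegral_mono' Measure.restrict_le_self fun q =>
          lintegral_mono' Measure.restrict_le_self le_rfl
    _ = _ := by
      simp_rw [inner]
      have hκ : Measurable fun q : E × E => ∫⁻ y, ψ (q.1, y) * ψ (q.2, y) ∂μ :=
        Measurable.lintegral_prod_right' (f := fun z : (E × E) × E =>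
          ψ (z.1.1, z.2) * ψ (z.1.2, z.2)) (by fun_prop)
      have hψψ : Measurable fun q : E × E => (∫⁻ y, ψ (q.1, y) ∂μ) * (∫⁻ y, ψ (q.2, y) ∂μ) :=
        (hψ1.comp measurable_fst).mul (hψ1.comp measurable_snd)
      rw [lintegral_add_left hψψ, hX.lintegral_intensity_pair hψψ, hX.lintegral_intensity_pair hκ]
      simp only []
      congr 2
      · rw [pow_two, ← lintegral_mul_const _ hψ1]
        exact lintegral_congr fun x => lintegral_const_mul _ hψ1
      · simp_rw [pow_two]
      · calc ∫⁻ x, ∫⁻ x', ∫⁻ y, ψ (x, y) * ψ (x', y) ∂μ ∂μ ∂μ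
            = ∫⁻ x, ∫⁻ y, ψ (x, y) * ∫⁻ x', ψ (x', y) ∂μ ∂μ ∂μ := by
              refine lintegral_congr fun x => ?_
              rw [lintegral_lintegral_swap (by fun_prop)]
              exact lintegral_congr fun y => lintegral_const_mul _ (by fun_prop)
          _ = ∫⁻ y, ∫⁻ x, ψ (x, y) * ∫⁻ x', ψ (x', y) ∂μ ∂μ ∂μ := by
              refine lintegral_lintegral_swap ?_
              exact (hψ.mul (hψ.lintegral_prod_left'.comp measurable_snd)).aemeasurable
          _ = _ := by
              refine lintegral_congr fun y => ?_
              rw [lintegral_mul_const _ (by fun_prop), pow_two]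
      · simp_rw [pow_two]

end IsPoissonProcess

/-! ### Almost sure convergence of Poisson sums and random series -/

theorem lintegral_le_of_forall_spanningSets {E : Type*} [MeasurableSpace E] {μ : Measure E}
    [SigmaFinite μ] {φ : E → ℝ≥0∞} {M : ℝ≥0∞}
    (h : ∀ n, ∫⁻ x in spanningSets μ n, φ x ∂μ ≤ M) : ∫⁻ x, φ x ∂μ ≤ M := by
  rw [← setLIntegral_univ, ← iUnion_spanningSets μ,
    setLIntegral_iUnion_of_directed _ (monotone_spanningSets μ).directed_le]
  exact iSup_le h

theorem setLIntegral_lt_top_of_le_one {E : Type*} [MeasurableSpace E] {μ : Measure E}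
    {φ : E → ℝ≥0∞} {S : Set E} (hS : μ S < ∞) (h : ∀ x, φ x ≤ 1) : ∫⁻ x in S, φ x ∂μ < ∞ :=
  (lintegral_mono h).trans_lt (by simpa using hS)

theorem sq_le_self_of_le_one {a : ℝ≥0∞} (h : a ≤ 1) : a ^ 2 ≤ a := by
  rw [pow_two]; exact mul_le_of_le_one_left' h

section

variable {Ω : Type*} [MeasurableSpace Ω] {P : Measure Ω} [IsProbabilityMeasure P]

/-- A series of pairwise negatively correlated `[0, 1]`-valued random variables that converges
almost surely has summable means. -/
theorem tsum_lintegral_lt_top {ι : Type*} [Countable ι] {X : ι → Ω → ℝ≥0∞}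
    (hX : ∀ i, Measurable (X i)) (h1 : ∀ i ω, X i ω ≤ 1)
    (hne : ∀ i j, i ≠ j → ∫⁻ ω, X i ω * X j ω ∂P ≤ (∫⁻ ω, X i ω ∂P) * ∫⁻ ω, X j ω ∂P)
    (h : ∀ᵐ ω ∂P, ∑' i, X i ω < ∞) : ∑' i, ∫⁻ ω, X i ω ∂P < ∞ := by
  obtain ⟨M, hM⟩ := exists_bound_lintegral (Measurable.tsum hX) h 1
  have hfin : ∀ i, ∫⁻ ω, X i ω ∂P < ∞ := fun i =>
    (lintegral_mono (h1 i)).trans_lt (by simp)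
  refine lt_of_le_of_lt ?_ (ENNReal.coe_lt_top (r := M))
  rw [ENNReal.tsum_eq_iSup_sum]
  refine iSup_le fun F => ?_
  rw [← lintegral_finsetSum F fun i _ => hX i]
  refine hM _ (Finset.measurable_fun_sum F fun i _ => hX i) (fun ω => ENNReal.sum_le_tsum F) ?_ ?_
  · rw [lintegral_finsetSum F fun i _ => hX i]
    exact (ENNReal.sum_lt_top.2 fun i _ => hfin i).ne
  · rw [ENNReal.coe_one, one_mul]
    exact lintegral_sq_sum_le F hX (fun i _ j _ hij => hne i j hij) fun i _ =>
      (lintegral_mono fun ω => sq_le_self_of_le_one (h1 i ω)).trans le_add_self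

end

namespace IsPoissonProcess

variable {Ω E : Type*} [MeasurableSpace Ω] [MeasurableSpace E] {P : Measure Ω}
  {μ : Measure E} {X : ℕ → Ω → E}

theorem measurable_tsum (hX : IsPoissonProcess P μ X) {φ : E → ℝ≥0∞} (hφ : Measurable φ) :
    Measurable fun ω => ∑' j, φ (X j ω) :=
  Measurable.tsum fun j => hφ.comp (hX.measurable j)

variable [SigmaFinite μ]

theorem lintegral_sq_tsum_le (hX : IsPoissonProcess P μ X) {φ : E → ℝ≥0∞} (hφ : Measurable φ)
    (h1 : ∀ x, φ x ≤ 1) : ∫⁻ ω, (∑' j, φ (X j ω)) ^ 2 ∂P ≤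
      (∫⁻ ω, ∑' j, φ (X j ω) ∂P) ^ 2 + ∫⁻ ω, ∑' j, φ (X j ω) ∂P := by
  have e : ∀ ω, (∑' j, φ (X j ω)) ^ 2 = ∑' p : ℕ × ℕ, φ (X p.1 ω) * φ (X p.2 ω) := by
    intro ω
    rw [pow_two, ← ENNReal.tsum_mul_right, ENNReal.tsum_prod']
    simp_rw [← ENNReal.tsum_mul_left]
  simp_rw [e]
  rw [hX.lintegral_tsum_pair (F := fun q => φ q.1 * φ q.2) (by fun_prop), hX.lintegral_tsum hφ]
  simp only [lintegral_const_mul _ hφ, lintegral_mul_const _ hφ, ← pow_two]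
  gcongr with x
  exact sq_le_self_of_le_one (h1 x)

/-- Cutting `φ` off to sets of finite measure makes the means finite, and the second moment method
bounds them by a constant independent of the cut-off. Exhaustion then gives the integral. -/
theorem lintegral_lt_top_of_ae [IsProbabilityMeasure P] (hX : IsPoissonProcess P μ X)
    {φ : E → ℝ≥0∞} (hφ : Measurable φ) (h1 : ∀ x, φ x ≤ 1)
    (h : ∀ᵐ ω ∂P, ∑' j, φ (X j ω) < ∞) : ∫⁻ x, φ x ∂μ < ∞ := by
  obtain ⟨M, hM⟩ := exists_bound_lintegral (hX.measurable_tsum hφ) h 1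
  refine lt_of_le_of_lt (lintegral_le_of_forall_spanningSets fun n => ?_)
    (ENNReal.coe_lt_top (r := M))
  have hS := measurableSet_spanningSets μ n
  have hφS := hφ.indicator hS
  have hle : ∀ x, (spanningSets μ n).indicator φ x ≤ φ x := Set.indicator_le_self _ _
  rw [← lintegral_indicator hS, ← hX.lintegral_tsum hφS]
  refine hM _ (hX.measurable_tsum hφS) (fun ω => ENNReal.tsum_le_tsum fun j => hle _) ?_ ?_
  · rw [hX.lintegral_tsum hφS, lintegral_indicator hS]
    exact (setLIntegral_lt_top_of_le_one (measure_spanningSets_lt_top μ n) h1).ne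
  · rw [ENNReal.coe_one, one_mul]
    exact hX.lintegral_sq_tsum_le hφS fun x => (hle x).trans (h1 x)

theorem ae_forall_notMem_iff (hX : IsPoissonProcess P μ X) {A : Set E} (hA : MeasurableSet A) :
    (∀ᵐ ω ∂P, ∀ j, X j ω ∉ A) ↔ μ A = 0 := by
  have hm := measurable_one.indicator (β := ℝ≥0∞) hA
  rw [← lintegral_indicator_one hA, ← hX.lintegral_tsum hm,
    lintegral_eq_zero_iff (hX.measurable_tsum hm)]
  refine Filter.eventually_congr (.of_forall fun ω => ?_)
  simp [ENNReal.tsum_eq_zero]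

theorem ae_tsum_lt_top_iff [IsProbabilityMeasure P] (hX : IsPoissonProcess P μ X)
    {φ : E → ℝ≥0∞} (hφ : Measurable φ) :
    (∀ᵐ ω ∂P, ∑' j, φ (X j ω) < ∞) ↔ ∫⁻ x, trunc (φ x) ∂μ < ∞ ∧ μ {x | φ x = ∞} = 0 := by
  have hA : MeasurableSet {x | φ x = ∞} := hφ (measurableSet_singleton _)
  have hT : Measurable fun x => trunc (φ x) := measurable_trunc.comp hφ
  rw [← hX.ae_forall_notMem_iff hA,
    Filter.eventually_congr (.of_forall fun _ => tsum_lt_top_iff_tsum_trunc),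
    Filter.eventually_and]
  refine and_congr ⟨fun h => hX.lintegral_lt_top_of_ae hT (fun x => trunc_le_one _) h, fun h => ?_⟩
    (by simp [lt_top_iff_ne_top])
  rw [← hX.lintegral_tsum hT] at h
  exact ae_lt_top (hX.measurable_tsum hT) h.ne

end IsPoissonProcess

/-- Almost sure convergence of Poisson integrals over independent Poisson processes. -/
theorem ae_tsum_tsum_lt_top_iff {Ω E : Type*} [MeasurableSpace Ω] [MeasurableSpace E]
    {P : Measure Ω} [IsProbabilityMeasure P] {μ : Measure E} [SigmaFinite μ] {X : ℕ → ℕ → Ω → E}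
    (hX : ∀ j, IsPoissonProcess P μ (X j))
    (hind : ∀ i j, i ≠ j → IndepFun (fun ω k => X i k ω) (fun ω k => X j k ω) P)
    {a : ℕ → E → ℝ≥0∞} (ha : ∀ j, Measurable (a j)) (h1 : ∀ j x, a j x ≤ 1) :
    (∀ᵐ ω ∂P, ∑' j, ∑' k, a j (X j k ω) < ∞) ↔ ∑' j, ∫⁻ x, a j x ∂μ < ∞ := by
  have hm : Measurable fun ω => ∑' j, ∑' k, a j (X j k ω) :=
    Measurable.tsum fun j => (hX j).measurable_tsum (ha j)
  constructor
  · intro h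
    obtain ⟨M, hM⟩ := exists_bound_lintegral hm h 1
    refine lt_of_le_of_lt ?_ (ENNReal.coe_lt_top (r := M))
    rw [ENNReal.tsum_eq_iSup_sum]
    refine iSup_le fun F => ?_
    rw [← lintegral_finsetSum F fun j _ => ha j]
    refine lintegral_le_of_forall_spanningSets fun n => ?_
    have hS := measurableSet_spanningSets μ n
    have haS : ∀ j, Measurable ((spanningSets μ n).indicator (a j)) := fun j =>
      (ha j).indicator hS
    have hle : ∀ j x, (spanningSets μ n).indicator (a j) x ≤ a j x := fun j =>
      Set.indicator_le_self _ _
    have hXm : ∀ j, Measurable fun ω => ∑' k, (spanningSets μ n).indicator (a j) (X j k ω) :=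
      fun j => (hX j).measurable_tsum (haS j)
    have e : ∀ j, ∫⁻ ω, ∑' k, (spanningSets μ n).indicator (a j) (X j k ω) ∂P =
        ∫⁻ x in spanningSets μ n, a j x ∂μ := fun j => by
      rw [(hX j).lintegral_tsum (haS j), lintegral_indicator hS]
    have key : ∫⁻ x in spanningSets μ n, ∑ j ∈ F, a j x ∂μ =
        ∫⁻ ω, ∑ j ∈ F, ∑' k, (spanningSets μ n).indicator (a j) (X j k ω) ∂P := by
      rw [lintegral_finsetSum F fun j _ => ha j, lintegral_finsetSum F fun j _ => hXm j]
      simp_rw [e]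
    rw [key]
    refine hM _ (Finset.measurable_fun_sum F fun j _ => hXm j) (fun ω => ?_) ?_ ?_
    · exact (Finset.sum_le_sum fun j _ => ENNReal.tsum_le_tsum fun k => hle j _).trans
        (ENNReal.sum_le_tsum (f := fun j => ∑' k, a j (X j k ω)) F)
    · rw [lintegral_finsetSum F fun j _ => hXm j]
      simp_rw [e]
      exact (ENNReal.sum_lt_top.2 fun j _ => setLIntegral_lt_top_of_le_one
        (measure_spanningSets_lt_top μ n) (h1 j)).ne
    · rw [ENNReal.coe_one, one_mul]
      -- Different `j` are uncorrelated by independence. The inner sums need not be bounded by 1, so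
      -- the diagonal terms use the Poisson second moment instead of $X^2\le X$.
      refine lintegral_sq_sum_le F hXm (fun i _ j _ hij => le_of_eq ?_) fun j _ =>
        (hX j).lintegral_sq_tsum_le (haS j) fun x => (hle j x).trans (h1 j x)
      have hφ : ∀ j, Measurable fun w : ℕ → E => ∑' k, (spanningSets μ n).indicator (a j) (w k) :=
        fun j => Measurable.tsum fun k => (haS j).comp (measurable_pi_apply k)
      exact lintegral_mul_eq_lintegral_mul_lintegral_of_indepFun (hXm i) (hXm j)
        ((hind i j hij).comp (hφ i) (hφ j))
  · intro h
    refine ae_lt_top hm (ne_of_lt ?_)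
    rw [lintegral_tsum fun j => ((hX j).measurable_tsum (ha j)).aemeasurable]
    simpa only [fun j => (hX j).lintegral_tsum (ha j)] using h

/-- Almost sure convergence of a series in a symmetric array of independent variables. -/
theorem ae_tsum_label_lt_top_iff {Ω L : Type*} [MeasurableSpace Ω] [MeasurableSpace L]
    {P : Measure Ω} [IsProbabilityMeasure P] {ν : Measure L} {ζ : Sym2 ℕ → Ω → L}
    (hζ : ∀ e, Measurable (ζ e)) (hlaw : ∀ e, HasLaw (ζ e) ν P)
    (hind : ∀ e e', e ≠ e' → IndepFun (ζ e) (ζ e') P)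
    {b : ℕ × ℕ → L → ℝ≥0∞} (hb : ∀ p, Measurable (b p)) (h1 : ∀ p x, b p x ≤ 1) :
    (∀ᵐ ω ∂P, ∑' p : ℕ × ℕ, b p (ζ s(p.1, p.2) ω) < ∞) ↔ ∑' p, ∫⁻ x, b p x ∂ν < ∞ := by
  have hbm : ∀ p : ℕ × ℕ, Measurable fun ω => b p (ζ s(p.1, p.2) ω) := fun p =>
    (hb p).comp (hζ _)
  have hint : ∀ p : ℕ × ℕ, ∫⁻ ω, b p (ζ s(p.1, p.2) ω) ∂P = ∫⁻ x, b p x ∂ν := fun p =>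
    (hlaw _).lintegral_comp (hb p).aemeasurable
  constructor
  · intro h
    -- The pairs $(i,j)$ and $(j,i)$ share a label, so their terms may be positively correlated. The
    -- method is applied separately to $i\le j$ and $j<i$, on each of which distinct pairs carry
    -- distinct labels.
    have key : ∀ I : Set (ℕ × ℕ), (∀ p ∈ I, ∀ q ∈ I, s(p.1, p.2) = s(q.1, q.2) → p = q) →
        ∑' p, I.indicator (fun p => ∫⁻ x, b p x ∂ν) p < ∞ := by
      intro I hI
      have := tsum_lintegral_lt_top (P := P)
        (X := fun p ω => I.indicator (fun p => b p (ζ s(p.1, p.2) ω)) p)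
        (fun p => by by_cases hp : p ∈ I <;> simp [hp, hbm])
        (fun p ω => (Set.indicator_le_self I (fun p : ℕ × ℕ => b p (ζ s(p.1, p.2) ω)) p).trans
          (h1 _ _)) ?_ ?_
      · refine lt_of_eq_of_lt (tsum_congr fun p => ?_) this
        by_cases hp : p ∈ I <;> simp [hp, hint]
      · intro p q hpq
        by_cases hp : p ∈ I
        · by_cases hq : q ∈ I
          · simp only [hp, hq, Set.indicator_of_mem]
            exact (lintegral_mul_eq_lintegral_mul_lintegral_of_indepFun (hbm p) (hbm q)
              ((hind _ _ fun h => hpq (hI p hp q hq h)).comp (hb p) (hb q))).le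
          · simp [hq]
        · simp [hp]
      · filter_upwards [h] with ω hω
        exact (ENNReal.tsum_le_tsum fun p => Set.indicator_le_self I
          (fun p : ℕ × ℕ => b p (ζ s(p.1, p.2) ω)) p).trans_lt hω
    have k1 := key {p | p.1 ≤ p.2} (by
      rintro ⟨i, j⟩ hp ⟨i', j'⟩ hq h
      simp only [Set.mem_ofPred_eq, Sym2.eq_iff, Prod.mk.injEq] at *
      omega)
    have k2 := key {p | p.2 < p.1} (by
      rintro ⟨i, j⟩ hp ⟨i', j'⟩ hq h
      simp only [Set.mem_ofPred_eq, Sym2.eq_iff, Prod.mk.injEq] at *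
      omega)
    refine lt_of_eq_of_lt ?_ (ENNReal.add_lt_top.2 ⟨k1, k2⟩)
    rw [← ENNReal.tsum_add]
    refine tsum_congr fun p => ?_
    by_cases hp : p.1 ≤ p.2
    · simp [hp, not_lt.2 hp]
    · simp [hp, not_le.1 hp]
  · intro h
    refine ae_lt_top (Measurable.tsum hbm) (ne_of_lt ?_)
    rw [lintegral_tsum fun p => (hbm p).aemeasurable]
    simpa only [hint] using h

/-! ### Lebesgue measure on the half line -/

section Leb

theorem leb_Iic (a : ℝ≥0) : leb (Set.Iic a) = a := by
  rw [leb, Measure.map_apply measurable_real_toNNReal measurableSet_Iic,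
    Measure.restrict_apply (measurable_real_toNNReal measurableSet_Iic)]
  have : Real.toNNReal ⁻¹' Set.Iic a ∩ Set.Ici 0 = Set.Icc 0 (a : ℝ) := by
    ext x
    simp only [Set.mem_inter_iff, Set.mem_preimage, Set.mem_Iic, Set.mem_Ici, Set.mem_Icc,
      Real.toNNReal_le_iff_le_coe]
    exact and_comm
  rw [this, Real.volume_Icc]
  simp

instance : SigmaFinite leb := by
  refine (Measure.FiniteSpanningSetsIn.sigmaFinite (C := Set.univ) (μ := leb)
    ⟨fun n => Set.Iic (n : ℝ≥0), fun _ => trivial, fun n => by simp [leb_Iic], ?_⟩)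
  refine Set.eq_univ_of_forall fun x => Set.mem_iUnion.2 ?_
  exact exists_nat_ge x

theorem leb_Ioc (a b : ℝ≥0) (hab : a ≤ b) : leb (Set.Ioc a b) = ↑(b - a) := by
  rw [← Set.Iic_sdiff_Iic, measure_sdiff (Set.Iic_subset_Iic.2 hab)
    measurableSet_Iic.nullMeasurableSet (by simp [leb_Iic]), leb_Iic, leb_Iic, ENNReal.coe_sub]

end Leb

/-! ### Freezing the vertices -/

namespace Noise.IsAdmissible

variable {Ω : Type*} [MeasurableSpace Ω] {N : Noise Ω} {P : Measure Ω}

theorem measurable_vertices (hN : N.IsAdmissible P) :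
    Measurable fun ω j => N.vertex j ω := measurable_pi_iff.2 hN.vertex.measurable

theorem measurable_stars (hN : N.IsAdmissible P) :
    Measurable fun ω j k => N.star j k ω :=
  measurable_pi_iff.2 fun j => measurable_pi_iff.2 (hN.star j).measurable

theorem measurable_labels (hN : N.IsAdmissible P) :
    Measurable fun ω e => N.label e ω := measurable_pi_iff.2 hN.measurable_label

theorem sigma_le (hN : N.IsAdmissible P) (s : Source) : N.sigma s ≤ ‹MeasurableSpace Ω› := by
  cases s with
  | vertex => exact hN.measurable_vertices.comap_le
  | star j => exact (measurable_pi_iff.2 (hN.star j).measurable).comap_le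
  | edge => exact (measurable_pi_iff.2 hN.edge.measurable).comap_le
  | label e => exact (hN.measurable_label e).comap_le
  | drift => exact (hN.measurable_β.prodMk hN.measurable_γ).comap_le

theorem indepFun_star (hN : N.IsAdmissible P) (i j : ℕ) (hij : i ≠ j) :
    IndepFun (fun ω k => N.star i k ω) (fun ω k => N.star j k ω) P :=
  hN.indep.indep (i := .star i) (j := .star j) (by simpa using hij)

theorem indepFun_label (hN : N.IsAdmissible P) (e e' : Sym2 ℕ) (h : e ≠ e') :
    IndepFun (N.label e) (N.label e') P :=
  hN.indep.indep (i := .label e) (j := .label e') (by simpa using h)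

theorem indepFun_vertices_stars (hN : N.IsAdmissible P) :
    IndepFun (fun ω j => N.vertex j ω) (fun ω j k => N.star j k ω) P := by
  have h := indep_iSup_of_disjoint hN.sigma_le hN.indep
    (S := {.vertex}) (T := Set.range .star) (by simp)
  refine indep_of_indep_of_le_left (indep_of_indep_of_le_right h ?_) ?_
  · rw [MeasurableSpace.pi, MeasurableSpace.comap_iSup]
    refine iSup_le fun j => ?_
    rw [MeasurableSpace.comap_comp]
    exact le_iSup₂_of_le (f := fun i _ => N.sigma i) (.star j) ⟨j, rfl⟩ le_rfl
  · exact le_iSup₂_of_le .vertex rfl le_rfl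

theorem indepFun_vertices_labels (hN : N.IsAdmissible P) :
    IndepFun (fun ω j => N.vertex j ω) (fun ω e => N.label e ω) P := by
  have h := indep_iSup_of_disjoint hN.sigma_le hN.indep
    (S := {.vertex}) (T := Set.range .label) (by simp)
  refine indep_of_indep_of_le_left (indep_of_indep_of_le_right h ?_) ?_
  · rw [MeasurableSpace.pi, MeasurableSpace.comap_iSup]
    refine iSup_le fun e => ?_
    rw [MeasurableSpace.comap_comp]
    exact le_iSup₂_of_le (f := fun i _ => N.sigma i) (.label e) ⟨e, rfl⟩ le_rfl
  · exact le_iSup₂_of_le .vertex rfl le_rfl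

variable [IsProbabilityMeasure P]

/-- For frozen vertices this is a series of Poisson integrals over independent processes, which
converges a.s. iff its conditional mean is finite. -/
theorem ae_tsum_star_lt_top_iff (hN : N.IsAdmissible P)
    {a : (ℝ≥0 × ℝ≥0) × ℝ≥0 × ℝ≥0 → ℝ≥0∞} (ha : Measurable a) (h1 : ∀ q, a q ≤ 1) :
    (∀ᵐ ω ∂P, ∑' j, ∑' k, a (N.vertex j ω, N.star j k ω) < ∞) ↔
      ∀ᵐ ω ∂P, ∑' j, ∫⁻ x, a (N.vertex j ω, x) ∂(leb.prod leb) < ∞ := by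
  rw [ae_lt_top_iff_of_indepFun hN.measurable_vertices hN.measurable_stars
    hN.indepFun_vertices_stars (F := fun p => ∑' j, ∑' k, a (p.1 j, p.2 j k))
    (Measurable.tsum fun j => Measurable.tsum fun k => by fun_prop)]
  refine Filter.eventually_congr (.of_forall fun ω => ?_)
  exact ae_tsum_tsum_lt_top_iff hN.star hN.indepFun_star (a := fun j x => a (N.vertex j ω, x))
    (fun j => by fun_prop) fun j x => h1 _

theorem ae_tsum_label_lt_top_iff (hN : N.IsAdmissible P)
    {b : ((ℝ≥0 × ℝ≥0) × ℝ≥0 × ℝ≥0) × ℝ≥0 → ℝ≥0∞} (hb : Measurable b) (h1 : ∀ q, b q ≤ 1) :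
    (∀ᵐ ω ∂P, ∑' p : ℕ × ℕ, b ((N.vertex p.1 ω, N.vertex p.2 ω), N.label s(p.1, p.2) ω) < ∞) ↔
      ∀ᵐ ω ∂P, ∑' p : ℕ × ℕ, ∫⁻ z in Set.Icc 0 1, b ((N.vertex p.1 ω, N.vertex p.2 ω), z) ∂leb
        < ∞ := by
  rw [ae_lt_top_iff_of_indepFun hN.measurable_vertices hN.measurable_labels
    hN.indepFun_vertices_labels
    (F := fun q => ∑' p : ℕ × ℕ, b ((q.1 p.1, q.1 p.2), q.2 s(p.1, p.2)))
    (Measurable.tsum fun p => by fun_prop)]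
  refine Filter.eventually_congr (.of_forall fun ω => ?_)
  exact Kallenberg.ae_tsum_label_lt_top_iff hN.measurable_label hN.label hN.indepFun_label
    (b := fun p z => b ((N.vertex p.1 ω, N.vertex p.2 ω), z))
    (fun j => by fun_prop) fun j x => h1 _

end Noise.IsAdmissible

/-! ### Kernels on pairs of marked points -/

/-- The function `ψ` of two marks, as a function of two marked points with positions in `S` and
`S'`. -/
noncomputable def markFun (S S' : Set ℝ≥0) (ψ : ℝ≥0 × ℝ≥0 → ℝ≥0∞)
    (q : (ℝ≥0 × ℝ≥0) × ℝ≥0 × ℝ≥0) : ℝ≥0∞ :=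
  S.indicator 1 q.1.1 * (S'.indicator 1 q.2.1 * ψ (q.1.2, q.2.2))

theorem indicator_one_le_one (S : Set ℝ≥0) (x : ℝ≥0) :
    S.indicator (1 : ℝ≥0 → ℝ≥0∞) x ≤ 1 :=
  Set.indicator_le_self' (fun _ _ => zero_le) x

section markFun

variable {S S' : Set ℝ≥0} {ψ ψ' : ℝ≥0 × ℝ≥0 → ℝ≥0∞}

theorem measurable_markFun (hS : MeasurableSet S) (hS' : MeasurableSet S') (hψ : Measurable ψ) :
    Measurable (markFun S S' ψ) := by
  have h1 := (measurable_one : Measurable (1 : ℝ≥0 → ℝ≥0∞)).indicator hS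
  have h2 := (measurable_one : Measurable (1 : ℝ≥0 → ℝ≥0∞)).indicator hS'
  unfold markFun
  exact (h1.comp (measurable_fst.comp measurable_fst)).mul
    ((h2.comp (measurable_fst.comp measurable_snd)).mul (by fun_prop))

theorem markFun_mono (h : ∀ q, ψ q ≤ ψ' q) (q) : markFun S S' ψ q ≤ markFun S S' ψ' q := by
  unfold markFun
  gcongr
  exact h _

theorem markFun_le_one (h : ∀ q, ψ q ≤ 1) (q) : markFun S S' ψ q ≤ 1 :=
  mul_le_one' (indicator_one_le_one _ _) (mul_le_one' (indicator_one_le_one _ _) (h _))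

theorem markFun_swap (q) : markFun S' S (fun q => ψ q.swap) q.swap = markFun S S' ψ q := by
  simp only [markFun, Prod.fst_swap, Prod.snd_swap, Prod.swap_prod_mk]
  ring

theorem lintegral_indicator_mul_snd (hS : MeasurableSet S) {φ : ℝ≥0 → ℝ≥0∞} (hφ : Measurable φ) :
    ∫⁻ q : ℝ≥0 × ℝ≥0, S.indicator 1 q.1 * φ q.2 ∂(leb.prod leb) = leb S * ∫⁻ x, φ x ∂leb := by
  rw [lintegral_prod_mul (measurable_one.indicator hS).aemeasurable hφ.aemeasurable,
    lintegral_indicator_one hS]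

theorem lintegral_markFun_right (hS' : MeasurableSet S') (hψ : Measurable ψ) (q : ℝ≥0 × ℝ≥0) :
    ∫⁻ q', markFun S S' ψ (q, q') ∂(leb.prod leb) =
      S.indicator 1 q.1 * (leb S' * ∫⁻ y, ψ (q.2, y) ∂leb) := by
  have h2 := (measurable_one : Measurable (1 : ℝ≥0 → ℝ≥0∞)).indicator hS'
  have h3 : Measurable fun q' : ℝ≥0 × ℝ≥0 =>
      S'.indicator (1 : ℝ≥0 → ℝ≥0∞) q'.1 * ψ (q.2, q'.2) :=
    (h2.comp measurable_fst).mul (by fun_prop)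
  simp only [markFun]
  rw [lintegral_const_mul _ h3,
    lintegral_indicator_mul_snd hS' (φ := fun y => ψ (q.2, y)) (by fun_prop)]

theorem lintegral_lintegral_markFun (hS : MeasurableSet S) (hS' : MeasurableSet S')
    (hψ : Measurable ψ) :
    ∫⁻ q, ∫⁻ q', markFun S S' ψ (q, q') ∂(leb.prod leb) ∂(leb.prod leb) =
      leb S * (leb S' * ∫⁻ x, ∫⁻ y, ψ (x, y) ∂leb ∂leb) := by
  simp_rw [lintegral_markFun_right hS' hψ]
  have h : Measurable fun x => ∫⁻ y, ψ (x, y) ∂leb := hψ.lintegral_prod_right'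
  rw [lintegral_indicator_mul_snd hS (φ := fun x => leb S' * ∫⁻ y, ψ (x, y) ∂leb)
    (h.const_mul _), lintegral_const_mul _ h]

/-- The factor `leb (S ∩ S')` is what disjoint strips are for: it removes the diagonal term from the
mean, while `S = S'` retains it. -/
theorem lintegral_markFun_diag (hS : MeasurableSet S) (hS' : MeasurableSet S')
    (hψ : Measurable ψ) :
    ∫⁻ q, markFun S S' ψ (q, q) ∂(leb.prod leb) = leb (S ∩ S') * ∫⁻ x, ψ (x, x) ∂leb := by
  rw [← lintegral_indicator_mul_snd (hS.inter hS') (φ := fun x => ψ (x, x)) (by fun_prop)]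
  refine lintegral_congr fun q => ?_
  rw [Set.inter_indicator_one, Pi.mul_apply, markFun, mul_assoc]

end markFun

theorem measurable_tsum_pair {Ω : Type*} [MeasurableSpace Ω] {P : Measure Ω}
    {V : ℕ → Ω → ℝ≥0 × ℝ≥0} (hV : IsPoissonProcess P (leb.prod leb) V)
    {F : (ℝ≥0 × ℝ≥0) × ℝ≥0 × ℝ≥0 → ℝ≥0∞} (hF : Measurable F) :
    Measurable fun ω => ∑' p : ℕ × ℕ, F (V p.1 ω, V p.2 ω) :=
  Measurable.tsum fun p => hF.comp (hV.measurable_pair p)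

/-! ### Necessity for the double sum -/

section Necessity

variable {Ω : Type*} [MeasurableSpace Ω] {P : Measure Ω} [IsProbabilityMeasure P]
  {V : ℕ → Ω → ℝ≥0 × ℝ≥0} {S S' : Set ℝ≥0} {ψ : ℝ≥0 × ℝ≥0 → ℝ≥0∞}

/-- Unit strips have measure 1, so all moments reduce to integrals of `φ` over marks. The point is
that `M` serves every such `φ` and every `k`, so `φ` may be chosen freely below `ψ`. -/
theorem exists_bound_of_ae_tsum_lt_top (hV : IsPoissonProcess P (leb.prod leb) V)
    (hS : MeasurableSet S) (hS' : MeasurableSet S') (hSS' : Disjoint S S') (hS1 : leb S = 1)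
    (hS1' : leb S' = 1) (hψ : Measurable ψ) (hψ1 : ∀ q, ψ q ≤ 1)
    (h : ∀ᵐ ω ∂P, ∑' p : ℕ × ℕ, markFun S S' ψ (V p.1 ω, V p.2 ω) < ∞) (K : ℝ≥0) :
    ∃ M : ℝ≥0, ∀ φ : ℝ≥0 × ℝ≥0 → ℝ≥0∞, Measurable φ → (∀ q, φ q ≤ ψ q) → ∀ k : ℝ≥0,
      (∀ q, q ∉ Set.Iic k ×ˢ Set.Iic k → φ q = 0) →
      ∫⁻ x, (∫⁻ y, φ (x, y) ∂leb) ^ 2 ∂leb + ∫⁻ y, (∫⁻ x, φ (x, y) ∂leb) ^ 2 ∂leb ≤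
        K * ((∫⁻ x, ∫⁻ y, φ (x, y) ∂leb ∂leb) ^ 2 + ∫⁻ x, ∫⁻ y, φ (x, y) ∂leb ∂leb) →
      ∫⁻ x, ∫⁻ y, φ (x, y) ∂leb ∂leb ≤ M := by
  -- `K` pays for the squared marginals; the extra 1 pays for the squared mean and for
  -- $\int\!\int\varphi^2\le\int\!\int\varphi$.
  obtain ⟨M, hM⟩ := exists_bound_lintegral
    (measurable_tsum_pair hV (measurable_markFun hS hS' hψ)) h (K + 1)
  refine ⟨M, fun φ hφ hle k hk hsq => ?_⟩
  have hmφ := measurable_markFun hS hS' hφ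
  have hR : MeasurableSet (S ×ˢ Set.Iic k) := hS.prod measurableSet_Iic
  have hR' : MeasurableSet (S' ×ˢ Set.Iic k) := hS'.prod measurableSet_Iic
  have hRR' : Disjoint (S ×ˢ Set.Iic k) (S' ×ˢ Set.Iic k) := by
    rw [Set.disjoint_prod]; exact Or.inl hSS'
  have hfR : leb.prod leb (S ×ˢ Set.Iic k) ≠ ∞ := by simp [Measure.prod_prod, hS1, leb_Iic]
  have hfR' : leb.prod leb (S' ×ˢ Set.Iic k) ≠ ∞ := by simp [Measure.prod_prod, hS1', leb_Iic]
  have hsupp : ∀ q, q ∉ (S ×ˢ Set.Iic k) ×ˢ (S' ×ˢ Set.Iic k) → markFun S S' φ q = 0 := by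
    intro q hq
    simp only [markFun]
    by_cases h1 : q.1.1 ∈ S
    · by_cases h2 : q.2.1 ∈ S'
      · rw [hk, mul_zero, mul_zero]
        intro h3
        exact hq ⟨⟨h1, h3.1⟩, h2, h3.2⟩
      · simp [h2]
    · simp [h1]
  have hmean : ∫⁻ ω, ∑' p : ℕ × ℕ, markFun S S' φ (V p.1 ω, V p.2 ω) ∂P =
      ∫⁻ x, ∫⁻ y, φ (x, y) ∂leb ∂leb := by
    rw [hV.lintegral_tsum_pair hmφ, lintegral_lintegral_markFun hS hS' hφ,
      lintegral_markFun_diag hS hS' hφ, hSS'.inter_eq, hS1, hS1']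
    simp
  have hswap : ∀ q', ∫⁻ q, markFun S S' φ (q, q') ∂(leb.prod leb) =
      S'.indicator 1 q'.1 * ∫⁻ x, φ (x, q'.2) ∂leb := by
    intro q'
    have := lintegral_markFun_right (S := S') hS (hφ.comp measurable_swap) q'
    rw [hS1, one_mul] at this
    refine Eq.trans (lintegral_congr fun q => ?_) this
    exact (markFun_swap (q, q')).symm
  have hind : ∀ (T : Set ℝ≥0) (t : ℝ≥0) (a : ℝ≥0∞), (T.indicator 1 t * a) ^ 2 =
      T.indicator 1 t * a ^ 2 := by
    intro T t a
    by_cases ht : t ∈ T <;> simp [ht]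
  have hφ1 : Measurable fun x => ∫⁻ y, φ (x, y) ∂leb := hφ.lintegral_prod_right'
  have hφ2 : Measurable fun y => ∫⁻ x, φ (x, y) ∂leb := hφ.lintegral_prod_left'
  have hfin : ∫⁻ x, ∫⁻ y, φ (x, y) ∂leb ∂leb ≠ ∞ := by
    rw [← lintegral_prod _ hφ.aemeasurable]
    have : ∀ q, φ q = (Set.Iic k ×ˢ Set.Iic k).indicator φ q := by
      intro q
      by_cases hq : q ∈ Set.Iic k ×ˢ Set.Iic k
      · rw [Set.indicator_of_mem hq]
      · rw [Set.indicator_of_notMem hq, hk q hq]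
    rw [lintegral_congr this, lintegral_indicator (measurableSet_Iic.prod measurableSet_Iic)]
    refine (setLIntegral_lt_top_of_le_one ?_ fun q => (hle q).trans (hψ1 q)).ne
    rw [Measure.prod_prod, leb_Iic]
    exact ENNReal.mul_lt_top ENNReal.coe_lt_top ENNReal.coe_lt_top
  rw [← hmean]
  refine hM _ (measurable_tsum_pair hV hmφ)
    (fun ω => ENNReal.tsum_le_tsum fun p => markFun_mono hle _) (by rwa [hmean]) ?_
  refine (hV.lintegral_sq_tsum_pair_le hR hR' hRR' hfR hfR' hmφ hsupp).trans ?_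
  have hlast : ∫⁻ q, ∫⁻ q', markFun S S' φ (q, q') ^ 2 ∂(leb.prod leb) ∂(leb.prod leb) ≤
      ∫⁻ x, ∫⁻ y, φ (x, y) ∂leb ∂leb := by
    refine (lintegral_mono fun q => lintegral_mono fun q' => sq_le_self_of_le_one
      (markFun_le_one (fun q => (hle q).trans (hψ1 q)) _)).trans (le_of_eq ?_)
    rw [lintegral_lintegral_markFun hS hS' hφ, hS1, hS1', one_mul, one_mul]
  rw [hmean, lintegral_lintegral_markFun hS hS' hφ, hS1, hS1', one_mul, one_mul]
  simp_rw [lintegral_markFun_right hS' hφ, hswap, hind, hS1', one_mul]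
  rw [lintegral_indicator_mul_snd hS (hφ1.pow_const 2),
    lintegral_indicator_mul_snd hS' (hφ2.pow_const 2), hS1, hS1', one_mul, one_mul]
  push_cast
  calc _ = (∫⁻ x, (∫⁻ y, φ (x, y) ∂leb) ^ 2 ∂leb + ∫⁻ y, (∫⁻ x, φ (x, y) ∂leb) ^ 2 ∂leb) +
        ((∫⁻ x, ∫⁻ y, φ (x, y) ∂leb ∂leb) ^ 2 +
          ∫⁻ q, ∫⁻ q', markFun S S' φ (q, q') ^ 2 ∂(leb.prod leb) ∂(leb.prod leb)) := by ring
    _ ≤ _ := by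
      rw [add_mul, one_mul]
      gcongr

theorem iUnion_Iic_natCast : ⋃ n : ℕ, Set.Iic (n : ℝ≥0) = Set.univ :=
  Set.eq_univ_of_forall fun x => Set.mem_iUnion.2 (exists_nat_ge x)

theorem monotone_Iic_natCast : Monotone fun n : ℕ => Set.Iic (n : ℝ≥0) := fun _ _ h =>
  Set.Iic_subset_Iic.2 (by exact_mod_cast h)

/-- A function with an almost surely finite double Poisson integral is integrable over the set
where both marginals are at most one. -/
theorem lintegral_lt_top_of_ae_tsum_lt_top (hV : IsPoissonProcess P (leb.prod leb) V)
    (hS : MeasurableSet S) (hS' : MeasurableSet S') (hSS' : Disjoint S S') (hS1 : leb S = 1)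
    (hS1' : leb S' = 1) (hψ : Measurable ψ) (hψ1 : ∀ q, ψ q ≤ 1)
    (h : ∀ᵐ ω ∂P, ∑' p : ℕ × ℕ, markFun S S' ψ (V p.1 ω, V p.2 ω) < ∞) :
    ∫⁻ x, ∫⁻ y, ψ (x, y) * (if max (∫⁻ y, ψ (x, y) ∂leb) (∫⁻ x, ψ (x, y) ∂leb) ≤ 1 then 1 else 0)
      ∂leb ∂leb < ∞ := by
  -- Once restricted to `G`, both marginals are at most 1, so each squared marginal integrates to at
  -- most the mass. Two marginals give the constant 2.
  obtain ⟨M, hM⟩ := exists_bound_of_ae_tsum_lt_top hV hS hS' hSS' hS1 hS1' hψ hψ1 h 2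
  have hm1 : Measurable fun x => ∫⁻ y, ψ (x, y) ∂leb := hψ.lintegral_prod_right'
  have hm2 : Measurable fun y => ∫⁻ x, ψ (x, y) ∂leb := hψ.lintegral_prod_left'
  set G : Set (ℝ≥0 × ℝ≥0) :=
    {q | max (∫⁻ y, ψ (q.1, y) ∂leb) (∫⁻ x, ψ (x, q.2) ∂leb) ≤ 1} with hG
  have hGm : MeasurableSet G :=
    measurableSet_le ((hm1.comp measurable_fst).max (hm2.comp measurable_snd)) measurable_const
  set φ : ℝ≥0 × ℝ≥0 → ℝ≥0∞ := G.indicator ψ with hφ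
  have hφm : Measurable φ := hψ.indicator hGm
  have e : ∀ x y, ψ (x, y) * (if max (∫⁻ y, ψ (x, y) ∂leb) (∫⁻ x, ψ (x, y) ∂leb) ≤ 1
      then 1 else 0) = φ (x, y) := by
    intro x y
    simp only [hφ, hG, Set.indicator, Set.mem_ofPred_eq]
    split_ifs <;> simp
  simp_rw [e]
  have hI : ∀ k : ℕ, MeasurableSet (Set.Iic (k : ℝ≥0) ×ˢ Set.Iic (k : ℝ≥0)) := fun k =>
    measurableSet_Iic.prod measurableSet_Iic
  have hU : ⋃ k : ℕ, Set.Iic (k : ℝ≥0) ×ˢ Set.Iic (k : ℝ≥0) = Set.univ := by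
    rw [Set.iUnion_prod_of_monotone monotone_Iic_natCast monotone_Iic_natCast,
      iUnion_Iic_natCast, Set.univ_prod_univ]
  rw [← lintegral_prod _ hφm.aemeasurable, ← setLIntegral_univ, ← hU,
    setLIntegral_iUnion_of_directed _ (Monotone.directed_le fun i j hij =>
      Set.prod_mono (monotone_Iic_natCast hij) (monotone_Iic_natCast hij))]
  refine lt_of_le_of_lt (iSup_le fun k => ?_) (ENNReal.coe_lt_top (r := M))
  have hφk := hφm.indicator (hI k)
  rw [← lintegral_indicator (hI k), lintegral_prod _ hφk.aemeasurable]
  have hle : ∀ q, (Set.Iic (k : ℝ≥0) ×ˢ Set.Iic (k : ℝ≥0)).indicator φ q ≤ ψ q := fun q =>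
    (Set.indicator_le_self _ _ q).trans (Set.indicator_le_self _ _ q)
  have hz : ∀ q, q ∉ G → (Set.Iic (k : ℝ≥0) ×ˢ Set.Iic (k : ℝ≥0)).indicator φ q = 0 := by
    intro q hq
    have : φ q = 0 := Set.indicator_of_notMem hq _
    simp [Set.indicator, this]
  refine hM _ hφk hle k (fun q hq => Set.indicator_of_notMem hq _) ?_
  have b1 : ∀ x, ∫⁻ y, (Set.Iic (k : ℝ≥0) ×ˢ Set.Iic (k : ℝ≥0)).indicator φ (x, y) ∂leb ≤ 1 := by
    intro x
    by_cases hx : ∫⁻ y, ψ (x, y) ∂leb ≤ 1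
    · exact (lintegral_mono fun y => hle _).trans hx
    · rw [lintegral_congr fun y => hz (x, y) fun h => hx ((le_max_left _ _).trans h)]
      simp
  have b2 : ∀ y, ∫⁻ x, (Set.Iic (k : ℝ≥0) ×ˢ Set.Iic (k : ℝ≥0)).indicator φ (x, y) ∂leb ≤ 1 := by
    intro y
    by_cases hy : ∫⁻ x, ψ (x, y) ∂leb ≤ 1
    · exact (lintegral_mono fun x => hle _).trans hy
    · rw [lintegral_congr fun x => hz (x, y) fun h => hy ((le_max_right _ _).trans h)]
      simp
  have s1 := lintegral_mono (μ := leb) fun x => sq_le_self_of_le_one (b1 x)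
  have s2 := lintegral_mono (μ := leb) fun y => sq_le_self_of_le_one (b2 y)
  rw [lintegral_lintegral_swap (f := fun y x =>
    (Set.Iic (k : ℝ≥0) ×ˢ Set.Iic (k : ℝ≥0)).indicator φ (x, y))
    (hφk.comp measurable_swap).aemeasurable] at s2
  refine (add_le_add s1 s2).trans ?_
  rw [← two_mul]
  push_cast
  gcongr
  exact le_add_self

/-- Rescale `ψ` over `B` so that its first marginal is exactly `c`. The mass is then $bc$ and the
second marginal is at most `b`, so the squared marginals contribute at most
$c^2b+cb^2=(b^{-1}+c^{-1})(bc)^2$. Bounded support forces a cut-off of `B`, which loses a factor 2.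
-/
theorem exists_bound_measure_mul (hV : IsPoissonProcess P (leb.prod leb) V)
    (hS : MeasurableSet S) (hS' : MeasurableSet S') (hSS' : Disjoint S S') (hS1 : leb S = 1)
    (hS1' : leb S' = 1) (hψ : Measurable ψ) (hψ1 : ∀ q, ψ q ≤ 1)
    (h : ∀ᵐ ω ∂P, ∑' p : ℕ × ℕ, markFun S S' ψ (V p.1 ω, V p.2 ω) < ∞) (K : ℝ≥0) :
    ∃ M : ℝ≥0, ∀ (B : Set ℝ≥0) (b c : ℝ≥0), MeasurableSet B → leb B = b →
      (∀ x ∈ B, (c : ℝ≥0∞) < ∫⁻ y, ψ (x, y) ∂leb) → b⁻¹ + c⁻¹ ≤ K → b * c ≤ M := by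
  obtain ⟨M, hM⟩ := exists_bound_of_ae_tsum_lt_top hV hS hS' hSS' hS1 hS1' hψ hψ1 h (2 * K)
  refine ⟨2 * M, fun B b c hB hb hc hK => ?_⟩
  rcases eq_or_ne b 0 with rfl | hb0
  · simp
  rcases eq_or_ne c 0 with rfl | hc0
  · simp
  set g : ℕ → ℝ≥0 → ℝ≥0∞ := fun k x => ∫⁻ y in Set.Iic (k : ℝ≥0), ψ (x, y) ∂leb with hg
  have hgm : ∀ k, Measurable (g k) := fun k => hψ.lintegral_prod_right'
  have hgmono : Monotone g := fun i j hij x => lintegral_mono_set (monotone_Iic_natCast hij)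
  have hgsup : ∀ x, ∫⁻ y, ψ (x, y) ∂leb = ⨆ k, g k x := fun x => by
    rw [← setLIntegral_univ, ← iUnion_Iic_natCast,
      setLIntegral_iUnion_of_directed _ monotone_Iic_natCast.directed_le]
  -- Points of `B` below `k` whose marginal already exceeds `c` when cut off at `k`. These sets
  -- increase to `B`, so one of them has measure above $b/2$.
  set Bk : ℕ → Set ℝ≥0 := fun k => (B ∩ Set.Iic (k : ℝ≥0)) ∩ {x | (c : ℝ≥0∞) < g k x} with hBk
  have hBkm : ∀ k, MeasurableSet (Bk k) := fun k =>
    (hB.inter measurableSet_Iic).inter (measurableSet_lt measurable_const (hgm k))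
  have hBmono : Monotone Bk := fun i j hij x hx =>
    ⟨⟨hx.1.1, monotone_Iic_natCast hij hx.1.2⟩, lt_of_lt_of_le hx.2 (hgmono hij x)⟩
  have hBU : ⋃ k, Bk k = B := by
    refine Set.Subset.antisymm (Set.iUnion_subset fun k x hx => hx.1.1) fun x hx => ?_
    have h1 := hc x hx
    rw [hgsup, lt_iSup_iff] at h1
    obtain ⟨i, hi⟩ := h1
    obtain ⟨j, hj⟩ := exists_nat_ge x
    exact Set.mem_iUnion.2 ⟨max i j, ⟨hx, hj.trans (by exact_mod_cast le_max_right i j)⟩,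
      lt_of_lt_of_le hi (hgmono (le_max_left i j) x)⟩
  have hsup : leb B = ⨆ k, leb (Bk k) := by
    rw [← hBU]; exact hBmono.directed_le.measure_iUnion
  have hlt : ((b / 2 : ℝ≥0) : ℝ≥0∞) < ⨆ k, leb (Bk k) := by
    rw [← hsup, hb]
    exact_mod_cast NNReal.half_lt_self hb0
  obtain ⟨k, hk⟩ := lt_iSup_iff.1 hlt
  have hβb : leb (Bk k) ≤ b := hb ▸ measure_mono fun x hx => hx.1.1
  have hβfin : leb (Bk k) ≠ ∞ := ne_top_of_le_ne_top ENNReal.coe_ne_top hβb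
  set φ : ℝ≥0 × ℝ≥0 → ℝ≥0∞ :=
    (Bk k ×ˢ Set.Iic (k : ℝ≥0)).indicator fun q => c / g k q.1 * ψ q with hφ
  have hφm : Measurable φ :=
    ((measurable_const.div ((hgm k).comp measurable_fst)).mul hψ).indicator
      ((hBkm k).prod measurableSet_Iic)
  have hle : ∀ q, φ q ≤ ψ q := by
    intro q
    by_cases hq : q ∈ Bk k ×ˢ Set.Iic (k : ℝ≥0)
    · rw [hφ, Set.indicator_of_mem hq]
      exact mul_le_of_le_one_left' (ENNReal.div_le_of_le_mul (by simpa using hq.1.2.le))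
    · rw [hφ, Set.indicator_of_notMem hq]
      exact zero_le
  have hgfin : ∀ x, g k x < ∞ := fun x => setLIntegral_lt_top_of_le_one
    (by simp [leb_Iic]) fun y => hψ1 _
  have hφ1 : ∀ x, ∫⁻ y, φ (x, y) ∂leb = (Bk k).indicator (fun _ => (c : ℝ≥0∞)) x := by
    intro x
    by_cases hx : x ∈ Bk k
    · have : ∀ y, φ (x, y) = (Set.Iic (k : ℝ≥0)).indicator (fun y => c / g k x * ψ (x, y)) y := by
        intro y
        simp [hφ, Set.indicator, hx]
      rw [lintegral_congr this, lintegral_indicator measurableSet_Iic,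
        lintegral_const_mul _ (by fun_prop), Set.indicator_of_mem hx]
      exact ENNReal.div_mul_cancel (ne_bot_of_gt hx.2) (hgfin x).ne
    · have : ∀ y, φ (x, y) = 0 := by
        intro y
        simp [hφ, hx]
      rw [lintegral_congr this, Set.indicator_of_notMem hx, lintegral_zero]
  have hmean : ∫⁻ x, ∫⁻ y, φ (x, y) ∂leb ∂leb = c * leb (Bk k) := by
    rw [lintegral_congr hφ1, lintegral_indicator_const (hBkm k)]
  have hφ2 : ∀ y, ∫⁻ x, φ (x, y) ∂leb ≤ leb (Bk k) := by
    intro y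
    rw [← lintegral_indicator_one (hBkm k)]
    refine lintegral_mono fun x => ?_
    by_cases hx : x ∈ Bk k
    · rw [Set.indicator_of_mem hx]
      exact (hle _).trans (hψ1 _)
    · simp [hφ, hx]
  have q1 : ∫⁻ x, (∫⁻ y, φ (x, y) ∂leb) ^ 2 ∂leb = c * (c * leb (Bk k)) := by
    have : ∀ x, (∫⁻ y, φ (x, y) ∂leb) ^ 2 = (Bk k).indicator (fun _ => (c : ℝ≥0∞) ^ 2) x := by
      intro x
      rw [hφ1]
      by_cases hx : x ∈ Bk k <;> simp [hx]
    rw [lintegral_congr this, lintegral_indicator_const (hBkm k)]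
    ring
  have q2 : ∫⁻ y, (∫⁻ x, φ (x, y) ∂leb) ^ 2 ∂leb ≤ leb (Bk k) * (c * leb (Bk k)) := by
    have hφ2m : Measurable fun y => ∫⁻ x, φ (x, y) ∂leb := hφm.lintegral_prod_left'
    rw [← hmean, lintegral_lintegral_swap (f := fun x y => φ (x, y)) hφm.aemeasurable,
      ← lintegral_const_mul _ hφ2m]
    refine lintegral_mono fun y => ?_
    rw [pow_two]
    gcongr
    exact hφ2 y
  have hfinal := hM φ hφm hle k (fun q hq => Set.indicator_of_notMem
    (fun hq' => hq ⟨hq'.1.1.2, hq'.2⟩) _) (by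
      rw [hmean, q1]
      refine (add_le_add le_rfl q2).trans ?_
      clear q1 q2 hmean hφ2 hφ1 hsup
      generalize leb (Bk k) = β at *
      lift β to ℝ≥0 using hβfin
      norm_cast at hk hβb ⊢
      have h1 : c ≤ 2 * b⁻¹ * (c * β) := by
        have : b ≤ 2 * β := by
          rw [← NNReal.coe_le_coe]
          rw [← NNReal.coe_lt_coe] at hk
          push_cast at hk ⊢
          linarith
        calc c = b⁻¹ * b * c := by field_simp
          _ ≤ b⁻¹ * (2 * β) * c := by gcongr
          _ = _ := by ring
      have h2 : β = c⁻¹ * (c * β) := by field_simp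
      calc c * (c * β) + β * (c * β) ≤ 2 * b⁻¹ * (c * β) * (c * β) + c⁻¹ * (c * β) * (c * β) := by
            gcongr
            exact h2.le
        _ = (2 * b⁻¹ + c⁻¹) * (c * β) ^ 2 := by ring
        _ ≤ (2 * (b⁻¹ + c⁻¹)) * (c * β) ^ 2 := by
            gcongr
            rw [mul_add, two_mul c⁻¹]
            gcongr
            exact le_self_add
        _ ≤ 2 * K * ((c * β) ^ 2 + c * β) := by
            gcongr
            exact le_self_add)
  rw [hmean] at hfinal
  have : ((c * (b / 2) : ℝ≥0) : ℝ≥0∞) ≤ M := by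
    refine le_trans ?_ hfinal
    rw [ENNReal.coe_mul]
    gcongr
  norm_cast at this
  calc b * c = 2 * (c * (b / 2)) := by field_simp
    _ ≤ 2 * M := by gcongr

/-- On a set of measure $b>0$ with infinite marginal, `c` could be arbitrarily large, contradicting
the bound on $bc$. For marginals above 1, the choice $c=1$ bounds the measure itself. -/
theorem measure_marginal_of_ae_tsum_lt_top (hV : IsPoissonProcess P (leb.prod leb) V)
    (hS : MeasurableSet S) (hS' : MeasurableSet S') (hSS' : Disjoint S S') (hS1 : leb S = 1)
    (hS1' : leb S' = 1) (hψ : Measurable ψ) (hψ1 : ∀ q, ψ q ≤ 1)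
    (h : ∀ᵐ ω ∂P, ∑' p : ℕ × ℕ, markFun S S' ψ (V p.1 ω, V p.2 ω) < ∞) :
    leb {x | ∫⁻ y, ψ (x, y) ∂leb = ∞} = 0 ∧ leb {x | 1 < ∫⁻ y, ψ (x, y) ∂leb} < ∞ := by
  have hm1 : Measurable fun x => ∫⁻ y, ψ (x, y) ∂leb := hψ.lintegral_prod_right'
  have hsup : ∀ A : Set ℝ≥0, leb A = ⨆ n : ℕ, leb (A ∩ Set.Iic (n : ℝ≥0)) := by
    intro A
    rw [← Directed.measure_iUnion, ← Set.inter_iUnion, iUnion_Iic_natCast, Set.inter_univ]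
    exact Monotone.directed_le fun i j hij =>
      Set.inter_subset_inter_right _ (monotone_Iic_natCast hij)
  have hfin : ∀ (A : Set ℝ≥0) (n : ℕ), leb (A ∩ Set.Iic (n : ℝ≥0)) ≠ ∞ := fun A n =>
    measure_ne_top_of_subset Set.inter_subset_right (by simp [leb_Iic])
  constructor
  · have hA : MeasurableSet {x | ∫⁻ y, ψ (x, y) ∂leb = ∞} := hm1 (measurableSet_singleton _)
    rw [hsup, ENNReal.iSup_eq_zero]
    intro n
    obtain ⟨b, hb⟩ : ∃ b : ℝ≥0,
        (b : ℝ≥0∞) = leb ({x | ∫⁻ y, ψ (x, y) ∂leb = ∞} ∩ Set.Iic (n : ℝ≥0)) :=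
      ⟨_, ENNReal.coe_toNNReal (hfin _ n)⟩
    by_contra hne
    have hb0 : b ≠ 0 := by rintro rfl; exact hne (by rw [← hb]; rfl)
    obtain ⟨M, hM⟩ := exists_bound_measure_mul hV hS hS' hSS' hS1 hS1' hψ hψ1 h (b⁻¹ + 1)
    -- This `c` is at least 1, so $b^{-1}+c^{-1}\le b^{-1}+1$ as required by the constant fixed
    -- before `M`, while $bc=b+M+1>M$.
    have := hM _ b (1 + b⁻¹ * (M + 1)) (hA.inter measurableSet_Iic) hb.symm (fun x hx => by
      rw [show ∫⁻ y, ψ (x, y) ∂leb = ∞ from hx.1]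
      exact ENNReal.coe_lt_top) (by
        gcongr
        exact inv_le_one_of_one_le₀ le_self_add)
    have e : b * (1 + b⁻¹ * (M + 1)) = b + (M + 1) := by field_simp
    rw [e] at this
    have h2 : M + 1 ≤ M := le_trans le_add_self this
    exact absurd h2 (not_le.2 (lt_add_one M))
  · have hA : MeasurableSet {x | 1 < ∫⁻ y, ψ (x, y) ∂leb} := measurableSet_lt measurable_const hm1
    obtain ⟨M, hM⟩ := exists_bound_measure_mul hV hS hS' hSS' hS1 hS1' hψ hψ1 h 2
    refine lt_of_le_of_lt ?_ (ENNReal.coe_lt_top (r := max M 1))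
    rw [hsup]
    refine iSup_le fun n => ?_
    obtain ⟨b, hb⟩ : ∃ b : ℝ≥0,
        (b : ℝ≥0∞) = leb ({x | 1 < ∫⁻ y, ψ (x, y) ∂leb} ∩ Set.Iic (n : ℝ≥0)) :=
      ⟨_, ENNReal.coe_toNNReal (hfin _ n)⟩
    rw [← hb, ENNReal.coe_le_coe]
    rcases le_total b 1 with h1 | h1
    · exact h1.trans (le_max_right _ _)
    · refine le_max_of_le_left ?_
      have := hM _ b 1 (hA.inter measurableSet_Iic) hb.symm
        (fun x hx => by simpa using hx.1) (by
          rw [inv_one, ← one_add_one_eq_two]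
          gcongr
          exact inv_le_one_of_one_le₀ h1)
      simpa using this

end Necessity

/-! ### Sufficiency for the double sum, and the two-sided criterion -/

theorem tsum_markFun_swap {Ω : Type*} {V : ℕ → Ω → ℝ≥0 × ℝ≥0} (ω : Ω) (S S' : Set ℝ≥0)
    (ψ : ℝ≥0 × ℝ≥0 → ℝ≥0∞) :
    ∑' p : ℕ × ℕ, markFun S' S (fun q => ψ q.swap) (V p.1 ω, V p.2 ω) =
      ∑' p : ℕ × ℕ, markFun S S' ψ (V p.1 ω, V p.2 ω) := by
  rw [← (Equiv.prodComm ℕ ℕ).tsum_eq]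
  exact tsum_congr fun p => markFun_swap (V p.1 ω, V p.2 ω)

section

variable {Ω : Type*} [MeasurableSpace Ω] {P : Measure Ω}
  {V : ℕ → Ω → ℝ≥0 × ℝ≥0} {S : Set ℝ≥0} {ψ : ℝ≥0 × ℝ≥0 → ℝ≥0∞}

theorem ae_tsum_markFun_lt_top (hV : IsPoissonProcess P (leb.prod leb) V)
    (hS : MeasurableSet S) (hS1 : leb S < ∞) (hψ : Measurable ψ)
    (h2 : ∫⁻ x, ∫⁻ y, ψ (x, y) ∂leb ∂leb < ∞) (hd : ∫⁻ x, ψ (x, x) ∂leb < ∞) :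
    ∀ᵐ ω ∂P, ∑' p : ℕ × ℕ, markFun S S ψ (V p.1 ω, V p.2 ω) < ∞ := by
  have hm := measurable_markFun hS hS hψ
  refine ae_lt_top (measurable_tsum_pair hV hm) (ne_of_lt ?_)
  rw [hV.lintegral_tsum_pair hm, lintegral_lintegral_markFun hS hS hψ,
    lintegral_markFun_diag hS hS hψ, Set.inter_self]
  exact ENNReal.add_lt_top.2 ⟨ENNReal.mul_lt_top hS1 (ENNReal.mul_lt_top hS1 h2),
    ENNReal.mul_lt_top hS1 hd⟩

/-- The contribution of the vertices with a large but finite marginal. -/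
theorem ae_tsum_markFun_lt_top_of_marginal (hV : IsPoissonProcess P (leb.prod leb) V)
    (hS : MeasurableSet S) (hS1 : leb S < ∞) (hψ : Measurable ψ)
    (hinf : leb {x | ∫⁻ y, ψ (x, y) ∂leb = ∞} = 0)
    (hone : leb {x | 1 < ∫⁻ y, ψ (x, y) ∂leb} < ∞) (hd : ∫⁻ x, ψ (x, x) ∂leb < ∞) :
    ∀ᵐ ω ∂P, ∑' p : ℕ × ℕ,
      markFun S S ({q | 1 < ∫⁻ y, ψ (q.1, y) ∂leb}.indicator ψ) (V p.1 ω, V p.2 ω) < ∞ := by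
  have hm1 : Measurable fun x => ∫⁻ y, ψ (x, y) ∂leb := hψ.lintegral_prod_right'
  have hA : MeasurableSet {x | 1 < ∫⁻ y, ψ (x, y) ∂leb} := measurableSet_lt measurable_const hm1
  have hfinite : ∀ᵐ ω ∂P, ∑' j, (S ×ˢ {x | 1 < ∫⁻ y, ψ (x, y) ∂leb}).indicator
      (1 : ℝ≥0 × ℝ≥0 → ℝ≥0∞) (V j ω) < ∞ := by
    have hm := (measurable_one : Measurable (1 : ℝ≥0 × ℝ≥0 → ℝ≥0∞)).indicator (hS.prod hA)
    refine ae_lt_top (hV.measurable_tsum hm) (ne_of_lt ?_)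
    rw [hV.lintegral_tsum hm, lintegral_indicator_one (hS.prod hA), Measure.prod_prod]
    exact ENNReal.mul_lt_top hS1 hone
  have hI : MeasurableSet {x | ∫⁻ y, ψ (x, y) ∂leb = ∞} := hm1 (measurableSet_singleton _)
  have hnotinf : ∀ᵐ ω ∂P, ∀ j, V j ω ∉ Set.univ ×ˢ {x | ∫⁻ y, ψ (x, y) ∂leb = ∞} := by
    rw [hV.ae_forall_notMem_iff (MeasurableSet.univ.prod hI),
      Measure.prod_prod, hinf, mul_zero]
  -- The whole marginal need not be integrable over $\{\psi_1>1\}$, but on $\{1<\psi_1\le n\}$ the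
  -- mean is finite. The level needed later depends on the vertex and on `ω`, so all `n` are treated
  -- at once.
  have hpart : ∀ n : ℕ, ∀ᵐ ω ∂P, ∑' p : ℕ × ℕ, markFun S S
      ({q | 1 < ∫⁻ y, ψ (q.1, y) ∂leb ∧ ∫⁻ y, ψ (q.1, y) ∂leb ≤ n}.indicator ψ)
        (V p.1 ω, V p.2 ω) < ∞ := by
    intro n
    have hB : MeasurableSet {x | 1 < ∫⁻ y, ψ (x, y) ∂leb ∧ ∫⁻ y, ψ (x, y) ∂leb ≤ n} :=
      hA.inter (measurableSet_le hm1 measurable_const)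
    refine ae_tsum_markFun_lt_top hV hS hS1 (hψ.indicator (measurable_fst hB)) ?_ ?_
    · calc _ ≤ ∫⁻ x, {x | 1 < ∫⁻ y, ψ (x, y) ∂leb}.indicator (fun _ => (n : ℝ≥0∞)) x ∂leb := by
            refine lintegral_mono fun x => ?_
            by_cases hx : 1 < ∫⁻ y, ψ (x, y) ∂leb
            · by_cases hxn : ∫⁻ y, ψ (x, y) ∂leb ≤ n
              · simp [Set.indicator, hx, hxn]
              · simp [Set.indicator, hxn]
            · simp [Set.indicator, hx]
        _ = n * leb {x | 1 < ∫⁻ y, ψ (x, y) ∂leb} := lintegral_indicator_const hA _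
        _ < ∞ := ENNReal.mul_lt_top (by simp) hone
    · exact (lintegral_mono fun x => Set.indicator_le_self _ _ _).trans_lt hd
  filter_upwards [hfinite, hnotinf, ae_all_iff.2 hpart] with ω h1 h2 h3
  have hF : {j | 1 ≤ (S ×ˢ {x | 1 < ∫⁻ y, ψ (x, y) ∂leb}).indicator
      (1 : ℝ≥0 × ℝ≥0 → ℝ≥0∞) (V j ω)}.Finite :=
    ENNReal.finite_const_le_of_tsum_ne_top h1.ne one_ne_zero
  -- Only finitely many first vertices contribute, and the row of each is part of the finite sum at
  -- some level `n`.
  rw [ENNReal.tsum_prod', tsum_eq_sum (s := hF.toFinset)]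
  · refine ENNReal.sum_lt_top.2 fun i _ => ?_
    have hi : ∫⁻ y, ψ ((V i ω).2, y) ∂leb ≠ ∞ := fun h => h2 i ⟨trivial, h⟩
    obtain ⟨n, hn⟩ := ENNReal.exists_nat_gt hi
    refine lt_of_le_of_lt ?_ (h3 n)
    rw [ENNReal.tsum_prod']
    refine le_trans (ENNReal.tsum_le_tsum fun j => ?_) (ENNReal.le_tsum i)
    refine mul_le_mul' le_rfl (mul_le_mul' le_rfl ?_)
    by_cases h : 1 < ∫⁻ y, ψ ((V i ω).2, y) ∂leb
    · simp [Set.indicator, h, hn.le]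
    · simp [Set.indicator, h]
  · intro i hi
    rw [Set.Finite.mem_toFinset, Set.mem_ofPred_eq] at hi
    refine ENNReal.tsum_eq_zero.2 fun j => ?_
    simp only [markFun]
    by_cases hiS : (V i ω).1 ∈ S
    · have : ¬ 1 < ∫⁻ y, ψ ((V i ω).2, y) ∂leb := fun h => hi (by
        have hmem : V i ω ∈ S ×ˢ {x | 1 < ∫⁻ y, ψ (x, y) ∂leb} := ⟨hiS, h⟩
        rw [Set.indicator_of_mem hmem]
        exact le_rfl)
      simp [Set.indicator, this]
    · simp [hiS]

/-- Almost sure local finiteness of a double Poisson integral. -/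
theorem forall_ae_tsum_markFun_lt_top_iff [IsProbabilityMeasure P]
    (hV : IsPoissonProcess P (leb.prod leb) V)
    (hψ : Measurable ψ) (hψ1 : ∀ q, ψ q ≤ 1) :
    (∀ n : ℕ, ∀ᵐ ω ∂P, ∑' p : ℕ × ℕ,
      markFun (Set.Iic (n : ℝ≥0)) (Set.Iic (n : ℝ≥0)) ψ (V p.1 ω, V p.2 ω) < ∞) ↔
    ((leb {x | ∫⁻ y, ψ (x, y) ∂leb = ∞} = 0 ∧ leb {x | 1 < ∫⁻ y, ψ (x, y) ∂leb} < ∞) ∧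
      (leb {y | ∫⁻ x, ψ (x, y) ∂leb = ∞} = 0 ∧ leb {y | 1 < ∫⁻ x, ψ (x, y) ∂leb} < ∞)) ∧
    ∫⁻ x, ∫⁻ y, ψ (x, y) * (if max (∫⁻ y, ψ (x, y) ∂leb) (∫⁻ x, ψ (x, y) ∂leb) ≤ 1 then 1 else 0)
      ∂leb ∂leb < ∞ ∧
    ∫⁻ x, ψ (x, x) ∂leb < ∞ := by
  have hswap : Measurable fun q : ℝ≥0 × ℝ≥0 => ψ q.swap := hψ.comp measurable_swap
  constructor
  · intro h
    -- Two disjoint unit strips inside $[0,2]$, so the hypothesis for the box with $n=2$ covers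
    -- both.
    set S := Set.Iic (1 : ℝ≥0) with hSdef
    set S' := Set.Ioc (1 : ℝ≥0) 2 with hSdef'
    have hS : MeasurableSet S := measurableSet_Iic
    have hS' : MeasurableSet S' := measurableSet_Ioc
    have hSS' : Disjoint S S' := Set.Iic_disjoint_Ioc le_rfl
    have hS1 : leb S = 1 := by simp [hSdef, leb_Iic]
    have hS1' : leb S' = 1 := by
      rw [hSdef', leb_Ioc 1 2 one_le_two, show (2 : ℝ≥0) - 1 = 1 from
        tsub_eq_of_eq_add (by norm_num)]
      rfl
    have hsub : S ⊆ Set.Iic ((2 : ℕ) : ℝ≥0) := Set.Iic_subset_Iic.2 (by norm_num)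
    have hsub' : S' ⊆ Set.Iic ((2 : ℕ) : ℝ≥0) := fun x hx => by simpa using hx.2
    have hstrip : ∀ᵐ ω ∂P, ∑' p : ℕ × ℕ, markFun S S' ψ (V p.1 ω, V p.2 ω) < ∞ := by
      filter_upwards [h 2] with ω hω
      refine (ENNReal.tsum_le_tsum fun p => ?_).trans_lt hω
      simp only [markFun]
      gcongr
    have hstrip' : ∀ᵐ ω ∂P, ∑' p : ℕ × ℕ,
        markFun S S' (fun q => ψ q.swap) (V p.1 ω, V p.2 ω) < ∞ := by
      filter_upwards [h 2] with ω hω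
      rw [tsum_markFun_swap]
      refine (ENNReal.tsum_le_tsum fun p => ?_).trans_lt hω
      simp only [markFun]
      gcongr
    refine ⟨⟨measure_marginal_of_ae_tsum_lt_top hV hS hS' hSS' hS1 hS1' hψ hψ1 hstrip,
      measure_marginal_of_ae_tsum_lt_top hV hS hS' hSS' hS1 hS1' hswap (fun q => hψ1 _) hstrip'⟩,
      lintegral_lt_top_of_ae_tsum_lt_top hV hS hS' hSS' hS1 hS1' hψ hψ1 hstrip, ?_⟩
    have hdm : Measurable fun q : ℝ≥0 × ℝ≥0 => markFun S S ψ (q, q) :=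
      (measurable_markFun hS hS hψ).comp (measurable_id.prodMk measurable_id)
    -- The terms $i=j$ form a single Poisson sum dominated by the double sum, so the one-dimensional
    -- criterion applies.
    have := hV.lintegral_lt_top_of_ae hdm (fun q => markFun_le_one hψ1 _) (by
      filter_upwards [h 1] with ω hω
      refine lt_of_le_of_lt ?_ hω
      rw [Nat.cast_one, ENNReal.tsum_prod']
      exact ENNReal.tsum_le_tsum fun j =>
        ENNReal.le_tsum (f := fun k => markFun S S ψ (V j ω, V k ω)) j)
    rwa [lintegral_markFun_diag hS hS hψ, Set.inter_self, hS1, one_mul] at this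
  · rintro ⟨⟨⟨h1, h2⟩, h1', h2'⟩, h3, h4⟩ n
    have hS : MeasurableSet (Set.Iic (n : ℝ≥0)) := measurableSet_Iic
    have hS1 : leb (Set.Iic (n : ℝ≥0)) < ∞ := by simp [leb_Iic]
    have hm1 : Measurable fun x => ∫⁻ y, ψ (x, y) ∂leb := hψ.lintegral_prod_right'
    have hm2 : Measurable fun y => ∫⁻ x, ψ (x, y) ∂leb := hψ.lintegral_prod_left'
    have hGm : MeasurableSet {q : ℝ≥0 × ℝ≥0 |
        max (∫⁻ y, ψ (q.1, y) ∂leb) (∫⁻ x, ψ (x, q.2) ∂leb) ≤ 1} :=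
      measurableSet_le ((hm1.comp measurable_fst).max (hm2.comp measurable_snd)) measurable_const
    have a0 := ae_tsum_markFun_lt_top hV hS hS1 (hψ.indicator hGm) (by
      refine lt_of_eq_of_lt (lintegral_congr fun x => lintegral_congr fun y => ?_) h3
      simp only [Set.indicator, Set.mem_ofPred_eq]
      split_ifs <;> simp) ((lintegral_mono fun x => Set.indicator_le_self _ _ _).trans_lt h4)
    have a1 := ae_tsum_markFun_lt_top_of_marginal hV hS hS1 hψ h1 h2 h4
    have a2 := ae_tsum_markFun_lt_top_of_marginal hV hS hS1 hswap h1' h2' h4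
    filter_upwards [a0, a1, a2] with ω b0 b1 b2
    rw [← tsum_markFun_swap] at b2
    -- Every pair of marks has both marginals at most 1, or a first marginal above 1, or a second
    -- one above 1; the three sums cover these cases.
    refine lt_of_le_of_lt ?_ (ENNReal.add_lt_top.2 ⟨b0, ENNReal.add_lt_top.2 ⟨b1, b2⟩⟩)
    rw [← ENNReal.tsum_add, ← ENNReal.tsum_add]
    refine ENNReal.tsum_le_tsum fun p => ?_
    simp only [markFun, ← mul_add]
    gcongr
    generalize (V p.1 ω).2 = x
    generalize (V p.2 ω).2 = y
    by_cases hx : 1 < ∫⁻ y, ψ (x, y) ∂leb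
    · simp [Set.indicator, hx]
      exact le_add_left le_self_add
    · by_cases hy : 1 < ∫⁻ x, ψ (x, y) ∂leb
      · simp [Set.indicator, hy]
        exact le_add_left le_add_self
      · rw [Set.indicator_of_mem (show (x, y) ∈ {q : ℝ≥0 × ℝ≥0 |
          max (∫⁻ y, ψ (q.1, y) ∂leb) (∫⁻ x, ψ (x, q.2) ∂leb) ≤ 1} from
          max_le (not_lt.1 hx) (not_lt.1 hy))]
        exact le_self_add

end

/-! ### Reduction to boxes -/

/-- The random measure is locally finite as soon as it is finite on the boxes `[0, n]²`. -/
theorem isLocallyFinite_iff_forall_nat {Ω : Type*} [MeasurableSpace Ω] {P : Measure Ω}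
    {ξ : Ω → Measure (ℝ≥0 × ℝ≥0)} :
    IsLocallyFinite P ξ ↔
      ∀ n : ℕ, ∀ᵐ ω ∂P, ξ ω (Set.Iic (n : ℝ≥0) ×ˢ Set.Iic (n : ℝ≥0)) < ∞ := by
  rw [IsLocallyFinite, ← ae_all_iff]
  refine Filter.eventually_congr (.of_forall fun ω => ⟨fun h n => ?_, fun h B _ hB => ?_⟩)
  · refine h _ (measurableSet_Iic.prod measurableSet_Iic) ?_
    have : Bornology.IsBounded (Set.Iic (n : ℝ≥0)) := by
      rw [← Set.Icc_bot]
      exact isCompact_Icc.isBounded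
    exact this.prod this
  · obtain ⟨r, hr⟩ := hB.subset_closedBall 0
    obtain ⟨n, hn⟩ := exists_nat_ge r
    refine (measure_mono fun q hq => ?_).trans_lt (h n)
    have h1 := hr hq
    rw [Metric.mem_closedBall, Prod.dist_eq, max_le_iff] at h1
    have h2 : ∀ x : ℝ≥0, dist x 0 ≤ r → x ≤ n := fun x hx => by
      rw [NNReal.dist_eq, NNReal.coe_zero, sub_zero] at hx
      exact_mod_cast (le_abs_self (x : ℝ)).trans (hx.trans hn)
    exact ⟨h2 _ h1.1, h2 _ h1.2⟩

theorem lebDiag_box_lt_top (n : ℝ≥0) : lebDiag (Set.Iic n ×ˢ Set.Iic n) < ∞ := by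
  have hd : Measurable fun x : ℝ≥0 => (x, x) := measurable_id.prodMk measurable_id
  have : (fun x : ℝ≥0 => (x, x)) ⁻¹' (Set.Iic n ×ˢ Set.Iic n) = Set.Iic n := by
    ext x; simp
  rw [lebDiag, Measure.smul_apply, Measure.map_apply hd (measurableSet_Iic.prod measurableSet_Iic),
    this, leb_Iic, smul_eq_mul]
  exact ENNReal.mul_lt_top ENNReal.ofReal_lt_top ENNReal.coe_lt_top

theorem smul_dirac_box (c : ℝ≥0∞) (S S' : Set ℝ≥0) (hS : MeasurableSet S)
    (hS' : MeasurableSet S') (x y : ℝ≥0) :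
    (c • Measure.dirac (x, y)) (S ×ˢ S') = S.indicator 1 x * (S'.indicator 1 y * c) := by
  rw [Measure.smul_apply, Measure.dirac_apply' _ (hS.prod hS'), Set.indicator_prod_one,
    smul_eq_mul]
  ring

/-- The drift terms are finite on boxes and drop out. A box $[0,n]^2$ is symmetric, so the
transposed terms take the same form as the original ones. -/
theorem randomMeasure_box_lt_top_iff {Ω : Type*} (C : Coeffs) (α : ℝ≥0) (N : Noise Ω) (ω : Ω)
    (n : ℝ≥0) :
    randomMeasure C α N ω (Set.Iic n ×ˢ Set.Iic n) < ∞ ↔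
      ∑' p : ℕ × ℕ, (Set.Iic n).indicator 1 (N.τ p.1 ω) * ((Set.Iic n).indicator 1 (N.τ p.2 ω) *
        (C.f (α, N.ϑ p.1 ω, N.ϑ p.2 ω, N.ζ p.1 p.2 ω) : ℝ≥0∞)) < ∞ ∧
      (∑' p : ℕ × ℕ, (Set.Iic n).indicator 1 (N.τ p.1 ω) *
          ((Set.Iic n).indicator 1 (N.σ p.1 p.2 ω) *
            (C.g (α, N.ϑ p.1 ω, N.χ p.1 p.2 ω) : ℝ≥0∞)) < ∞ ∧
        ∑' p : ℕ × ℕ, (Set.Iic n).indicator 1 (N.τ p.1 ω) *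
          ((Set.Iic n).indicator 1 (N.σ p.1 p.2 ω) *
            (C.g' (α, N.ϑ p.1 ω, N.χ p.1 p.2 ω) : ℝ≥0∞)) < ∞) ∧
      (∑' j, n * ((Set.Iic n).indicator 1 (N.τ j ω) * (C.h (α, N.ϑ j ω) : ℝ≥0∞)) < ∞ ∧
        ∑' j, n * ((Set.Iic n).indicator 1 (N.τ j ω) * (C.h' (α, N.ϑ j ω) : ℝ≥0∞)) < ∞) ∧
      (∑' k, (Set.Iic n).indicator 1 (N.ρ k ω) * ((Set.Iic n).indicator 1 (N.ρ' k ω) *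
          (C.l (α, N.η k ω) : ℝ≥0∞)) < ∞ ∧
        ∑' k, (Set.Iic n).indicator 1 (N.ρ k ω) * ((Set.Iic n).indicator 1 (N.ρ' k ω) *
          (C.l' (α, N.η k ω) : ℝ≥0∞)) < ∞) := by
  have hI : MeasurableSet (Set.Iic n) := measurableSet_Iic
  have hB : MeasurableSet (Set.Iic n ×ˢ Set.Iic n) := hI.prod hI
  have hβ : ((N.β ω : ℝ≥0∞) • lebDiag) (Set.Iic n ×ˢ Set.Iic n) < ∞ :=
    ENNReal.mul_lt_top ENNReal.coe_lt_top (lebDiag_box_lt_top n)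
  have hγ : ((N.γ ω : ℝ≥0∞) • leb.prod leb) (Set.Iic n ×ˢ Set.Iic n) < ∞ := by
    rw [Measure.smul_apply, Measure.prod_prod, leb_Iic]
    exact ENNReal.mul_lt_top ENNReal.coe_lt_top
      (ENNReal.mul_lt_top ENNReal.coe_lt_top ENNReal.coe_lt_top)
  have e1 : ∀ (c : ℝ≥0∞) (x : ℝ≥0), (c • (Measure.dirac x).prod leb) (Set.Iic n ×ˢ Set.Iic n) =
      n * ((Set.Iic n).indicator 1 x * c) := by
    intro c x
    rw [Measure.smul_apply, Measure.prod_prod, Measure.dirac_apply' _ hI, leb_Iic, smul_eq_mul]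
    ring
  have e2 : ∀ (c : ℝ≥0∞) (x : ℝ≥0), (c • leb.prod (Measure.dirac x)) (Set.Iic n ×ˢ Set.Iic n) =
      n * ((Set.Iic n).indicator 1 x * c) := by
    intro c x
    rw [Measure.smul_apply, Measure.prod_prod, Measure.dirac_apply' _ hI, leb_Iic, smul_eq_mul]
    ring
  have e3 : ∀ (c : ℝ≥0∞) (x y : ℝ≥0), (c • Measure.dirac (x, y)) (Set.Iic n ×ˢ Set.Iic n) =
      (Set.Iic n).indicator 1 x * ((Set.Iic n).indicator 1 y * c) := fun c x y =>
    smul_dirac_box c _ _ hI hI x y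
  have e4 : ∀ (c : ℝ≥0∞) (x y : ℝ≥0), (c • Measure.dirac (y, x)) (Set.Iic n ×ˢ Set.Iic n) =
      (Set.Iic n).indicator 1 x * ((Set.Iic n).indicator 1 y * c) := fun c x y => by
    rw [e3]; ring
  simp only [randomMeasure, Measure.add_apply, Measure.sum_apply _ hB, ENNReal.add_lt_top, hβ, hγ,
    and_true, ENNReal.tsum_add, e1, e2, and_assoc]
  simp only [e3 _ (N.τ _ ω) (N.τ _ ω), e3 _ (N.τ _ ω) (N.σ _ _ ω), e4 _ (N.τ _ ω) (N.σ _ _ ω),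
    e3 _ (N.ρ _ ω) (N.ρ' _ ω), e4 _ (N.ρ _ ω) (N.ρ' _ ω)]

/-! ### The components -/

theorem trunc_indicator_mul {E : Type*} (S : Set E) (x : E) (a : ℝ≥0∞) :
    trunc (S.indicator 1 x * a) = S.indicator 1 x * trunc a := by
  by_cases h : x ∈ S <;> simp [h, trunc]

theorem measurable_indicator_one_comp {E : Type*} [MeasurableSpace E] {S : Set ℝ≥0}
    (hS : MeasurableSet S) {u : E → ℝ≥0} (hu : Measurable u) :
    Measurable fun x => S.indicator (1 : ℝ≥0 → ℝ≥0∞) (u x) :=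
  ((measurable_one : Measurable (1 : ℝ≥0 → ℝ≥0∞)).indicator hS).comp hu

section

variable {Ω : Type*} [MeasurableSpace Ω] {P : Measure Ω} [IsProbabilityMeasure P]

/-- Positions only contribute a factor $n$, so $n=1$ already gives necessity. Infinite values of `φ`
are allowed because $g_1$ and $g_1'$ will be inserted here. -/
theorem forall_ae_tsum_mark_lt_top_iff {V : ℕ → Ω → ℝ≥0 × ℝ≥0}
    (hV : IsPoissonProcess P (leb.prod leb) V) {φ : ℝ≥0 → ℝ≥0∞} (hφ : Measurable φ) :
    (∀ n : ℕ, ∀ᵐ ω ∂P, ∑' j, ((n : ℝ≥0) : ℝ≥0∞) *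
        ((Set.Iic (n : ℝ≥0)).indicator 1 (V j ω).1 * φ (V j ω).2) < ∞) ↔
      ∫⁻ x, trunc (φ x) ∂leb < ∞ ∧ leb {x | φ x = ∞} = 0 := by
  have key : ∀ n : ℕ, (∀ᵐ ω ∂P,
      ∑' j, (Set.Iic (n : ℝ≥0)).indicator 1 (V j ω).1 * φ (V j ω).2 < ∞) ↔
      ((n : ℝ≥0) : ℝ≥0∞) * ∫⁻ x, trunc (φ x) ∂leb < ∞ ∧
        ((n : ℝ≥0) : ℝ≥0∞) * leb {x | φ x = ∞} = 0 := by
    intro n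
    have hm : Measurable fun q : ℝ≥0 × ℝ≥0 => (Set.Iic (n : ℝ≥0)).indicator 1 q.1 * φ q.2 :=
      (measurable_indicator_one_comp measurableSet_Iic measurable_fst).mul (by fun_prop)
    rw [hV.ae_tsum_lt_top_iff hm]
    simp_rw [trunc_indicator_mul]
    rw [lintegral_indicator_mul_snd measurableSet_Iic (φ := fun x => trunc (φ x))
      (measurable_trunc.comp hφ), leb_Iic]
    have : {q : ℝ≥0 × ℝ≥0 | (Set.Iic (n : ℝ≥0)).indicator 1 q.1 * φ q.2 = ∞} =
        Set.Iic (n : ℝ≥0) ×ˢ {x | φ x = ∞} := by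
      ext q
      by_cases h : q.1 ∈ Set.Iic (n : ℝ≥0)
      · simp [Set.mem_prod, h]
      · simp [Set.mem_prod, h]
    rw [this, Measure.prod_prod, leb_Iic]
  constructor
  · intro h
    have h1 := (key 1).1 (by
      filter_upwards [h 1] with ω hω
      simpa only [Nat.cast_one, ENNReal.coe_one, one_mul] using hω)
    simpa only [Nat.cast_one, ENNReal.coe_one, one_mul] using h1
  · rintro ⟨h1, h2⟩ n
    filter_upwards [(key n).2 ⟨ENNReal.mul_lt_top ENNReal.coe_lt_top h1, by rw [h2, mul_zero]⟩]
      with ω hω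
    rw [ENNReal.tsum_mul_left]
    exact ENNReal.mul_lt_top ENNReal.coe_lt_top hω

theorem forall_ae_tsum_edge_lt_top_iff {W : ℕ → Ω → ℝ≥0 × ℝ≥0 × ℝ≥0}
    (hW : IsPoissonProcess P (leb.prod (leb.prod leb)) W) {φ : ℝ≥0 → ℝ≥0∞} (hφ : Measurable φ)
    (hfin : ∀ x, φ x < ∞) :
    (∀ n : ℕ, ∀ᵐ ω ∂P, ∑' k, (Set.Iic (n : ℝ≥0)).indicator 1 (W k ω).1 *
        ((Set.Iic (n : ℝ≥0)).indicator 1 (W k ω).2.1 * φ (W k ω).2.2) < ∞) ↔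
      ∫⁻ x, trunc (φ x) ∂leb < ∞ := by
  have hT : Measurable fun x => trunc (φ x) := measurable_trunc.comp hφ
  have key : ∀ n : ℕ, (∀ᵐ ω ∂P, ∑' k, (Set.Iic (n : ℝ≥0)).indicator 1 (W k ω).1 *
        ((Set.Iic (n : ℝ≥0)).indicator 1 (W k ω).2.1 * φ (W k ω).2.2) < ∞) ↔
      ((n : ℝ≥0) : ℝ≥0∞) * (((n : ℝ≥0) : ℝ≥0∞) * ∫⁻ x, trunc (φ x) ∂leb) < ∞ := by
    intro n
    have h1 : ∀ {ψ : ℝ≥0 → ℝ≥0∞}, Measurable ψ → Measurable fun q : ℝ≥0 × ℝ≥0 =>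
        (Set.Iic (n : ℝ≥0)).indicator 1 q.1 * ψ q.2 := fun hψ =>
      (measurable_indicator_one_comp measurableSet_Iic measurable_fst).mul (by fun_prop)
    have hm : Measurable fun q : ℝ≥0 × ℝ≥0 × ℝ≥0 => (Set.Iic (n : ℝ≥0)).indicator 1 q.1 *
        ((Set.Iic (n : ℝ≥0)).indicator 1 q.2.1 * φ q.2.2) :=
      (measurable_indicator_one_comp measurableSet_Iic measurable_fst).mul
        ((h1 hφ).comp measurable_snd)
    rw [hW.ae_tsum_lt_top_iff hm]
    simp_rw [trunc_indicator_mul]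
    have hempty : {q : ℝ≥0 × ℝ≥0 × ℝ≥0 | (Set.Iic (n : ℝ≥0)).indicator 1 q.1 *
        ((Set.Iic (n : ℝ≥0)).indicator 1 q.2.1 * φ q.2.2) = ∞} = ∅ := by
      refine Set.eq_empty_of_forall_notMem fun q hq => ?_
      refine (ENNReal.mul_lt_top (lt_of_le_of_lt (indicator_one_le_one _ _) ENNReal.one_lt_top)
        (ENNReal.mul_lt_top (lt_of_le_of_lt (indicator_one_le_one _ _) ENNReal.one_lt_top)
          (hfin _))).ne hq
    rw [hempty, measure_empty, lintegral_prod_mul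
      (measurable_indicator_one_comp measurableSet_Iic measurable_id).aemeasurable
      (h1 hT).aemeasurable (f := fun x => (Set.Iic (n : ℝ≥0)).indicator (1 : ℝ≥0 → ℝ≥0∞) x),
      lintegral_indicator_mul_snd measurableSet_Iic hT, lintegral_indicator_one measurableSet_Iic,
      leb_Iic]
    simp
  constructor
  · intro h
    simpa using (key 1).1 (h 1)
  · intro h n
    exact (key n).2 (ENNReal.mul_lt_top ENNReal.coe_lt_top
      (ENNReal.mul_lt_top ENNReal.coe_lt_top h))

/-- Given the vertices, the star sum converges iff $\sum_j n\,\varphi_1(\vartheta_j)<\infty$ over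
vertices with positions in $[0,n]$, where $\varphi_1=\int\hat\varphi(\cdot,y)\,dy$. The criterion
for marks then truncates a second time and excludes $\varphi_1=\infty$, whence (ii) and (iii). -/
theorem Noise.IsAdmissible.forall_ae_tsum_star_lt_top_iff {N : Noise Ω} (hN : N.IsAdmissible P)
    {φ : ℝ≥0 × ℝ≥0 → ℝ≥0∞} (hφ : Measurable φ) (hfin : ∀ q, φ q < ∞) :
    (∀ n : ℕ, ∀ᵐ ω ∂P, ∑' p : ℕ × ℕ, (Set.Iic (n : ℝ≥0)).indicator 1 (N.τ p.1 ω) *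
        ((Set.Iic (n : ℝ≥0)).indicator 1 (N.σ p.1 p.2 ω) * φ (N.ϑ p.1 ω, N.χ p.1 p.2 ω)) < ∞) ↔
      ∫⁻ x, trunc (∫⁻ y, trunc (φ (x, y)) ∂leb) ∂leb < ∞ ∧
        leb {x | ∫⁻ y, trunc (φ (x, y)) ∂leb = ∞} = 0 := by
  have hT : Measurable fun q => trunc (φ q) := measurable_trunc.comp hφ
  rw [← forall_ae_tsum_mark_lt_top_iff hN.vertex (φ := fun x => ∫⁻ y, trunc (φ (x, y)) ∂leb)
    hT.lintegral_prod_right']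
  refine forall_congr' fun n => ?_
  have hm := measurable_markFun (measurableSet_Iic (a := (n : ℝ≥0)))
    (measurableSet_Iic (a := (n : ℝ≥0))) hT
  have h := hN.ae_tsum_star_lt_top_iff hm (fun q => markFun_le_one (fun q => trunc_le_one _) q)
  refine Iff.trans (Filter.eventually_congr (.of_forall fun ω => ?_)) (h.trans
    (Filter.eventually_congr (.of_forall fun ω => ?_)))
  · rw [tsum_lt_top_iff_tsum_trunc]
    simp_rw [trunc_indicator_mul]
    rw [ENNReal.tsum_prod']
    refine and_iff_left fun p => ENNReal.mul_lt_top
      (lt_of_le_of_lt (indicator_one_le_one _ _) ENNReal.one_lt_top)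
        (ENNReal.mul_lt_top (lt_of_le_of_lt (indicator_one_le_one _ _) ENNReal.one_lt_top)
          (hfin _))
  · refine iff_of_eq (congrArg (· < ∞) (tsum_congr fun j => ?_))
    rw [lintegral_markFun_right measurableSet_Iic hT, leb_Iic]
    ring

/-- Given the vertices, the labels can be replaced by their mean, leaving a double sum over the
vertex process alone. -/
theorem Noise.IsAdmissible.forall_ae_tsum_label_lt_top_iff {N : Noise Ω} (hN : N.IsAdmissible P)
    {φ : ℝ≥0 × ℝ≥0 × ℝ≥0 → ℝ≥0∞} (hφ : Measurable φ) (hfin : ∀ q, φ q < ∞) :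
    (∀ n : ℕ, ∀ᵐ ω ∂P, ∑' p : ℕ × ℕ, (Set.Iic (n : ℝ≥0)).indicator 1 (N.τ p.1 ω) *
        ((Set.Iic (n : ℝ≥0)).indicator 1 (N.τ p.2 ω) *
          φ (N.ϑ p.1 ω, N.ϑ p.2 ω, N.ζ p.1 p.2 ω)) < ∞) ↔
      ∀ n : ℕ, ∀ᵐ ω ∂P, ∑' p : ℕ × ℕ, markFun (Set.Iic (n : ℝ≥0)) (Set.Iic (n : ℝ≥0))
        (fun q => ∫⁻ z in Set.Icc 0 1, trunc (φ (q.1, q.2, z)) ∂leb)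
          (N.vertex p.1 ω, N.vertex p.2 ω) < ∞ := by
  have hT : Measurable fun q => trunc (φ q) := measurable_trunc.comp hφ
  refine forall_congr' fun n => ?_
  have hind := measurable_indicator_one_comp (S := Set.Iic (n : ℝ≥0)) measurableSet_Iic
    measurable_id
  have h := hN.ae_tsum_label_lt_top_iff (b := fun q => (Set.Iic (n : ℝ≥0)).indicator 1 q.1.1.1 *
    ((Set.Iic (n : ℝ≥0)).indicator 1 q.1.2.1 * trunc (φ (q.1.1.2, q.1.2.2, q.2))))
    (((hind.comp (by fun_prop : Measurable
      fun q : ((ℝ≥0 × ℝ≥0) × ℝ≥0 × ℝ≥0) × ℝ≥0 => q.1.1.1))).mul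
      ((hind.comp (by fun_prop : Measurable
        fun q : ((ℝ≥0 × ℝ≥0) × ℝ≥0 × ℝ≥0) × ℝ≥0 => q.1.2.1)).mul (hT.comp (by fun_prop))))
    (fun q => mul_le_one' (indicator_one_le_one _ _)
      (mul_le_one' (indicator_one_le_one _ _) (trunc_le_one _)))
  refine Iff.trans (Filter.eventually_congr (.of_forall fun ω => ?_)) (h.trans
    (Filter.eventually_congr (.of_forall fun ω => ?_)))
  · rw [tsum_lt_top_iff_tsum_trunc]
    simp_rw [trunc_indicator_mul]
    exact and_iff_left fun p => ENNReal.mul_lt_top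
      (lt_of_le_of_lt (indicator_one_le_one _ _) ENNReal.one_lt_top)
        (ENNReal.mul_lt_top (lt_of_le_of_lt (indicator_one_le_one _ _) ENNReal.one_lt_top)
          (hfin _))
  · refine iff_of_eq (congrArg (· < ∞) (tsum_congr fun p => ?_))
    have hz : Measurable fun z => trunc (φ ((N.vertex p.1 ω).2, (N.vertex p.2 ω).2, z)) :=
      hT.comp (by fun_prop)
    simp only [markFun]
    rw [lintegral_const_mul _ (hz.const_mul _), lintegral_const_mul _ hz]

end

end Kallenberg

/-! ### Assembly of the criterion -/

open Kallenberg in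
theorem theorem2 {Ω : Type*} [MeasurableSpace Ω] (P : Measure Ω) [IsProbabilityMeasure P]
    (C : Kallenberg.Coeffs) (α : ℝ≥0) (N : Kallenberg.Noise Ω) (hN : N.IsAdmissible P) :
    Kallenberg.IsLocallyFinite P (Kallenberg.randomMeasure C α N) ↔ C.Conditions α := by
  have mf : Measurable fun q : ℝ≥0 × ℝ≥0 × ℝ≥0 => (C.f (α, q) : ℝ≥0∞) :=
    (C.measurable_f.comp (by fun_prop)).coe_nnreal_ennreal
  have mg : Measurable fun q : ℝ≥0 × ℝ≥0 => (C.g (α, q) : ℝ≥0∞) :=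
    (C.measurable_g.comp (by fun_prop)).coe_nnreal_ennreal
  have mg' : Measurable fun q : ℝ≥0 × ℝ≥0 => (C.g' (α, q) : ℝ≥0∞) :=
    (C.measurable_g'.comp (by fun_prop)).coe_nnreal_ennreal
  have mh : Measurable fun x : ℝ≥0 => (C.h (α, x) : ℝ≥0∞) :=
    (C.measurable_h.comp (by fun_prop)).coe_nnreal_ennreal
  have mh' : Measurable fun x : ℝ≥0 => (C.h' (α, x) : ℝ≥0∞) :=
    (C.measurable_h'.comp (by fun_prop)).coe_nnreal_ennreal
  have ml : Measurable fun x : ℝ≥0 => (C.l (α, x) : ℝ≥0∞) :=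
    (C.measurable_l.comp (by fun_prop)).coe_nnreal_ennreal
  have ml' : Measurable fun x : ℝ≥0 => (C.l' (α, x) : ℝ≥0∞) :=
    (C.measurable_l'.comp (by fun_prop)).coe_nnreal_ennreal
  have hψ : Measurable fun q : ℝ≥0 × ℝ≥0 =>
      ∫⁻ z in Set.Icc 0 1, trunc (C.f (α, q.1, q.2, z)) ∂leb :=
    Measurable.lintegral_prod_right' (f := fun r : (ℝ≥0 × ℝ≥0) × ℝ≥0 =>
      trunc (C.f (α, r.1.1, r.1.2, r.2))) (measurable_trunc.comp (mf.comp (by fun_prop)))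
  have hψ1 : ∀ q : ℝ≥0 × ℝ≥0, ∫⁻ z in Set.Icc 0 1, trunc (C.f (α, q.1, q.2, z)) ∂leb ≤ 1 := by
    intro q
    refine (lintegral_mono fun z => trunc_le_one _).trans ?_
    rw [lintegral_one, Measure.restrict_apply_univ, ← bot_eq_zero, Set.Icc_bot, leb_Iic]
    rfl
  -- The marginals of this kernel are `C.f₁ α` and `C.f₂ α` by definition, so the criterion for
  -- double sums yields (iv), (v) and (vi).
  have F := (hN.forall_ae_tsum_label_lt_top_iff mf fun q => ENNReal.coe_lt_top).trans
    (forall_ae_tsum_markFun_lt_top_iff hN.vertex hψ hψ1)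
  have G := hN.forall_ae_tsum_star_lt_top_iff mg fun q => ENNReal.coe_lt_top
  have G' := hN.forall_ae_tsum_star_lt_top_iff mg' fun q => ENNReal.coe_lt_top
  have H := forall_ae_tsum_mark_lt_top_iff hN.vertex mh
  have H' := forall_ae_tsum_mark_lt_top_iff hN.vertex mh'
  have L := forall_ae_tsum_edge_lt_top_iff hN.edge ml fun q => ENNReal.coe_lt_top
  have L' := forall_ae_tsum_edge_lt_top_iff hN.edge ml' fun q => ENNReal.coe_lt_top
  have mT : ∀ {u : ℝ≥0 → ℝ≥0∞}, Measurable u → Measurable fun x => trunc (u x) := fun hu =>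
    measurable_trunc.comp hu
  have mg₁ : Measurable (C.g₁ α) :=
    Measurable.lintegral_prod_right' (f := fun q => trunc (C.g (α, q))) (measurable_trunc.comp mg)
  have hi : (∫⁻ x, (trunc (C.l (α, x)) + trunc (C.l' (α, x)) + trunc (C.h (α, x)) +
      trunc (C.h' (α, x))) ∂leb < ∞) ↔ ((∫⁻ x, trunc (C.l (α, x)) ∂leb < ∞ ∧
        ∫⁻ x, trunc (C.l' (α, x)) ∂leb < ∞) ∧ ∫⁻ x, trunc (C.h (α, x)) ∂leb < ∞) ∧
        ∫⁻ x, trunc (C.h' (α, x)) ∂leb < ∞ := by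
    rw [lintegral_add_right _ (mT mh'), lintegral_add_right _ (mT mh),
      lintegral_add_right _ (mT ml')]
    simp only [ENNReal.add_lt_top]
  have hiii : (∫⁻ x, (trunc (C.g₁ α x) + trunc (C.g'₁ α x)) ∂leb < ∞) ↔
      ∫⁻ x, trunc (C.g₁ α x) ∂leb < ∞ ∧ ∫⁻ x, trunc (C.g'₁ α x) ∂leb < ∞ := by
    rw [lintegral_add_left (mT mg₁), ENNReal.add_lt_top]
  have hv : ∫⁻ x, ∫⁻ y, ∫⁻ z in Set.Icc 0 1, trunc (C.f (α, x, y, z)) *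
      (if max (C.f₁ α x) (C.f₂ α y) ≤ 1 then 1 else 0) ∂leb ∂leb ∂leb =
      ∫⁻ x, ∫⁻ y, (∫⁻ z in Set.Icc 0 1, trunc (C.f (α, x, y, z)) ∂leb) *
        (if max (C.f₁ α x) (C.f₂ α y) ≤ 1 then 1 else 0) ∂leb ∂leb := by
    refine lintegral_congr fun x => lintegral_congr fun y => ?_
    exact lintegral_mul_const _ (measurable_trunc.comp (mf.comp (by fun_prop)))
  rw [isLocallyFinite_iff_forall_nat]
  simp_rw [randomMeasure_box_lt_top_iff, Filter.eventually_and, forall_and]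
  constructor
  · rintro ⟨h1, ⟨h2, h3⟩, ⟨h4, h5⟩, h6, h7⟩
    obtain ⟨f4, f5, f6⟩ := F.1 h1
    obtain ⟨g3, g2⟩ := G.1 h2
    obtain ⟨g3', g2'⟩ := G'.1 h3
    exact ⟨hi.2 ⟨⟨⟨L.1 h6, L'.1 h7⟩, (H.1 h4).1⟩, (H'.1 h5).1⟩, ⟨g2, g2'⟩, hiii.2 ⟨g3, g3'⟩,
      f4, hv.trans_lt f5, f6⟩
  · rintro ⟨c1, c2, c3, c4, c5, c6⟩
    obtain ⟨⟨⟨i1, i2⟩, i3⟩, i4⟩ := hi.1 c1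
    obtain ⟨g3, g3'⟩ := hiii.1 c3
    exact ⟨F.2 ⟨c4, hv.symm.trans_lt c5, c6⟩, ⟨G.2 ⟨g3, c2.1⟩, G'.2 ⟨g3', c2.2⟩⟩,
      ⟨H.2 ⟨i3, by simp⟩, H'.2 ⟨i4, by simp⟩⟩, L.2 i1, L'.2 i2⟩
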